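/- Let $d\ge 3$. For a dyadic interval $I$ let $h_I=-\mathbf 1_{I_{\mathrm{left}}}+\mathbf 1_{I_{\mathrm{right}}}$, and for a dyadic rectangle $R=R_1\times\cdots\times R_d\subset[0,1]^d$ let $h_R(x)=\prod_{k=1}^d h_{R_k}(x_k)$. For $n\ge 1$ let signs $\alpha(R)\in\{\pm1\}$ be given for all dyadic rectangles $R\subset[0,1]^d$ with $|R|=2^{-n}$. Let $\mathbb H_n$ be the set of all vectors $\vec r=(r_1,\dots,r_d)$ of nonnegative integers with $r_1+\cdots+r_d=n$, and for $\vec r\in\mathbb H_n$ put $f_{\vec r}=\sum_R \alpha(R)h_R$, the sum being over the dyadic rectangles $R\subset[0,1]^d$ with $|R_k|=2^{-r_k}$ for $1\le k\le d$. Let $0<a<1$, $0<\kappa<1$, and set $$q=\lfloor a n^{\varepsilon}\rfloor,\qquad \varepsilon=\frac1{2d}-\kappa,\qquad \rho=\sqrt q\,n^{-(d-1)/2}.$$ Suppose that $q\ge 1$, divide $\{1,\dots,n\}$ into $q$ disjoint increasing intervals $I_1,\dots,I_q$ of equal length (of lengths $\lfloor n/q\rfloor$ or $\lfloor n/q\rfloor+1$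 if $q\nmid n$), and let $$F_t=\sum_{\vec r\in\mathbb H_n,\; r_1\in I_t} f_{\vec r},\qquad 1\le t\le q .$$ Then there are constants $0<c<1$ and $C>0$ depending only on $d$ such that, for all $n,a,\kappa$ as above, all such divisions, all choices of signs and all $1\le t\le q$, $$\|\rho F_t\|_p\le C\sqrt p\qquad\text{whenever } 1\le p\le c\,(n/q)^{1/(2d-1)},$$ and $$\mathbb P(|\rho F_t|>x)\le C\exp(-c x^2)\qquad\text{whenever } 0\le x<c\,(n/q)^{1/(4d-2)},$$ where the $L^p$ norm and the probability $\mathbb P$ are taken with respect to Lebesgue measure on $[0,1]^d$. -/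

import Mathlib

open MeasureTheory

namespace SignedSmallBall

/-- A dyadic subinterval of `[0,1)`: the interval `[pos / 2 ^ scale, (pos + 1) / 2 ^ scale)`,
of length `2 ^ (-scale)`. -/
structure DyadicInterval where
  scale : ℕ
  pos : Fin (2 ^ scale)

namespace DyadicInterval

/-- The left endpoint. -/
noncomputable def left (I : DyadicInterval) : ℝ := (I.pos : ℝ) / 2 ^ I.scale

/-- The midpoint. -/
noncomputable def mid (I : DyadicInterval) : ℝ := ((I.pos : ℝ) + 1 / 2) / 2 ^ I.scale

/-- The right endpoint. -/
noncomputable def right (I : DyadicInterval) : ℝ := ((I.pos : ℝ) + 1) / 2 ^ I.scale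

/-- The `L^∞`-normalized Haar function `h_I`: it is `-1` on the left half of `I`, `1` on the
right half of `I`, and `0` off `I`. -/
noncomputable def haar (I : DyadicInterval) (x : ℝ) : ℝ :=
  -(Set.Ico I.left I.mid).indicator 1 x + (Set.Ico I.mid I.right).indicator 1 x

end DyadicInterval

/-- A dyadic rectangle in `[0,1)^d`, given by its sides. -/
abbrev DyadicRectangle (d : ℕ) : Type := Fin d → DyadicInterval

/-- The Haar function `h_R` of a dyadic rectangle. -/
noncomputable def haarRect {d : ℕ} (R : DyadicRectangle d) (x : Fin d → ℝ) : ℝ :=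
  ∏ k, (R k).haar (x k)

/-- `f_r = ∑ α(R) h_R`, the sum over the dyadic rectangles `R ⊆ [0,1)^d` with
`|R_k| = 2 ^ (-r_k)` for every coordinate `k`. -/
noncomputable def rFun {d : ℕ} (α : DyadicRectangle d → ℝ) (r : Fin d → ℕ) (x : Fin d → ℝ) : ℝ :=
  ∑ j : (∀ k, Fin (2 ^ r k)),
    α (fun k => ⟨r k, j k⟩) * haarRect (fun k => ⟨r k, j k⟩) x

/-- The hyperbolic vectors: all `r ∈ ℕ^d` with `r_1 + ⋯ + r_d = n`. -/
def hyperbolic (d n : ℕ) : Finset (Fin d → ℕ) := Finset.piAntidiag Finset.univ n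

/-- `I 0, …, I (q - 1)` divide `{1, …, n}` into `q` consecutive disjoint increasing intervals of
equal length. If `q` does not divide `n`, equal means that every length is `⌊n/q⌋` or
`⌊n/q⌋ + 1`; if `q ∣ n`, the two end conditions force all lengths to be `n/q`. -/
def IsEqualDivision (n q : ℕ) (I : Fin q → Finset ℕ) : Prop :=
  ∃ b : ℕ → ℕ, b 0 = 0 ∧ b q = n ∧
    ∀ t : Fin q, I t = Finset.Ioc (b t) (b (t + 1)) ∧
      (b (t + 1) = b t + n / q ∨ b (t + 1) = b t + n / q + 1)

/-- The block sum `F_t`: the sum of the `f_r` over the hyperbolic vectors `r` whose first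
coordinate (of index `0`) lies in the block `J = I_t`. -/
noncomputable def blockSum {d : ℕ} [NeZero d] (n : ℕ) (J : Finset ℕ)
    (α : DyadicRectangle d → ℝ) (x : Fin d → ℝ) : ℝ :=
  ∑ r ∈ (hyperbolic d n).filter (fun r => r 0 ∈ J), rFun α r x

/-- `q = ⌊a n^ε⌋` with `ε = 1/(2d) - κ`. -/
noncomputable def blockCount (d n : ℕ) (a κ : ℝ) : ℕ :=
  ⌊a * (n : ℝ) ^ (1 / (2 * (d : ℝ)) - κ)⌋₊

/-- The normalization `ρ = √q n^{-(d-1)/2}`. -/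
noncomputable def rho (d n q : ℕ) : ℝ := √(q : ℝ) * (n : ℝ) ^ (-(((d : ℝ) - 1) / 2))

/-- Lebesgue measure on the unit cube `[0,1]^d`. -/
noncomputable def cubeMeasure (d : ℕ) : Measure (Fin d → ℝ) :=
  volume.restrict (Set.Icc 0 1)

end SignedSmallBall

/-! Only the first `n + 1` binary digits of each coordinate matter, so the problem lives on a finite
uniform space. There `f_r` is odd under the flip of digit `r_k` of coordinate `k` and unchanged by
flips of later digits of that coordinate (`isFlipSystem_digitFun`). Grouping by the value of one
coordinate therefore gives a conditionally symmetric martingale. For these, even with Hilbert space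
values, the square function inequality holds in `L^{2m}` with constant of order `√m`
(`sum_norm_pow_le_square_function`).

Applied in the first coordinate, it reduces the claim to the square function `∑_c (∑_{r_0 = c}
f_r)^2`. This is the Hilbert-Schmidt norm of the Gram matrix of an array with rows indexed by `r_0`
and a single column. The remaining coordinates, except one that the condition `∑ r_k = n` makes
redundant, are then used one by one to refine this array. By `momentNorm_correlation_le`, the norm
is at most twice the norm with the coordinate added to the row index, plus `720 m K²` times the norm
with it added to the column index, where `2^K > n`. The reason is a dyadic merging of slices: each
merge adds a cross term, again a martingale, whose square function is a trace of a product of two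
Gram matrices and so is at most the product of their norms.

If every coordinate goes to the rows, the Gram sum is the number of vectors in the slab, at most
`|J| (n+1)^(d-2)`; this is the main term. If some coordinate goes to the columns, counting and one
more square function estimate (`momentNorm_leaf_le`) replace `|J|` by `√|J|` at a cost of `√m`. The
total cost of these branches is of order `(m K²)^(d-2) √m`. For `m` up to a multiple of `lam =
(n/q)^(1/(2d-1))`, with the logarithms bounded by a multiple of one further factor `lam`, it is at
most a multiple of `lam^(d-1/2) = √(n/q)`, exactly what the leaf gains (`moment_bound_le`). The
Gaussian tail is Markov's inequality at the exponent `p = c y²`. -/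

namespace SignedSmallBall

/-! ### Square function inequality for conditionally symmetric sums -/

/-- From `1 + x ≤ exp x` and `cosh x ≤ exp (x² / 2)` with `x = m h / B`. -/
theorem average_pow_le_exp {m : ℕ} {B h : ℝ} (hB : 0 < B) (hh : |h| ≤ B) :
    ((B + h) ^ m + (B - h) ^ m) / 2 ≤ B ^ m * Real.exp (m ^ 2 * h ^ 2 / (2 * B ^ 2)) := by
  have key : ∀ g : ℝ, |g| ≤ B → (B + g) ^ m ≤ B ^ m * Real.exp (m * g / B) := by
    intro g hg
    have h0 : 0 ≤ B + g := by linarith [neg_abs_le g]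
    have h1 : B + g ≤ B * Real.exp (g / B) := by
      have := Real.add_one_le_exp (g / B)
      calc B + g = B * (g / B + 1) := by field_simp; ring
        _ ≤ _ := by gcongr
    calc (B + g) ^ m ≤ (B * Real.exp (g / B)) ^ m := by gcongr
      _ = _ := by rw [mul_pow, ← Real.exp_nat_mul]; ring_nf
  have h1 := key h hh
  have h2 := key (-h) (by rwa [abs_neg])
  have h3 := Real.cosh_le_exp_half_sq (m * h / B)
  have h4 : (m * h / B) ^ 2 / 2 = m ^ 2 * h ^ 2 / (2 * B ^ 2) := by field_simp
  rw [h4, Real.cosh_eq] at h3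
  have h5 : B ^ m * ((Real.exp (m * h / B) + Real.exp (-(m * h / B))) / 2) ≤
      B ^ m * Real.exp (m ^ 2 * h ^ 2 / (2 * B ^ 2)) := by gcongr
  have h6 : (m : ℝ) * -h / B = -(m * h / B) := by ring
  rw [h6, ← sub_eq_add_neg] at h2
  linarith

/-- First and second symmetric differences are bounded together because each feeds the recursion of
the other in the induction on `m`. The factors of `U` stand in for exponents `m - 2` and `m - 1`,
avoiding subtraction in `ℕ`. -/
theorem second_difference_pow_le (m : ℕ) {A h U : ℝ} (hh : 0 ≤ h) (hA : h ≤ A) (hU : A + h ≤ U) :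
    (((A + h) ^ m + (A - h) ^ m) / 2 - A ^ m) * U ^ 2 ≤ m ^ 2 * h ^ 2 * U ^ m ∧
    ((A + h) ^ m - (A - h) ^ m) / 2 * U ≤ m * h * U ^ m := by
  have hA0 : 0 ≤ A := hh.trans hA
  have hU0 : 0 ≤ U := by linarith
  induction m with
  | zero => simp
  | succ m ih =>
    obtain ⟨h1, h2⟩ := ih
    have hp : (A + h) ^ m ≤ U ^ m := by gcongr
    have hq : (A - h) ^ m ≤ U ^ m := pow_le_pow_left₀ (by linarith) (by linarith) m
    have hAU : A ≤ U := by linarith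
    have hUm : 0 ≤ U ^ m := by positivity
    set p := (A + h) ^ m with hpdef
    set q := (A - h) ^ m with hqdef
    have e1 : ((A + h) ^ (m + 1) + (A - h) ^ (m + 1)) / 2 - A ^ (m + 1) =
      A * ((p + q) / 2 - A ^ m) + h * ((p - q) / 2) := by
      rw [hpdef, hqdef]; ring
    have e2 : ((A + h) ^ (m + 1) - (A - h) ^ (m + 1)) / 2 =
      A * ((p - q) / 2) + h * ((p + q) / 2) := by
      rw [hpdef, hqdef]; ring
    rw [e1, e2]
    push_cast
    have hm : (0 : ℝ) ≤ m := Nat.cast_nonneg m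
    constructor
    · calc (A * ((p + q) / 2 - A ^ m) + h * ((p - q) / 2)) * U ^ 2
          = A * (((p + q) / 2 - A ^ m) * U ^ 2) + h * U * ((p - q) / 2 * U) := by ring
        _ ≤ A * (m ^ 2 * h ^ 2 * U ^ m) + h * U * (m * h * U ^ m) := by gcongr
        _ ≤ U * (m ^ 2 * h ^ 2 * U ^ m) + h * U * (m * h * U ^ m) := by gcongr
        _ = (m ^ 2 + m) * (h ^ 2 * U ^ (m + 1)) := by ring
        _ ≤ (m + 1) ^ 2 * (h ^ 2 * U ^ (m + 1)) := by gcongr; nlinarith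
        _ = _ := by ring
    · calc (A * ((p - q) / 2) + h * ((p + q) / 2)) * U
          = A * ((p - q) / 2 * U) + h * U * ((p + q) / 2) := by ring
        _ ≤ A * (m * h * U ^ m) + h * U * ((U ^ m + U ^ m) / 2) := by gcongr
        _ ≤ U * (m * h * U ^ m) + h * U * ((U ^ m + U ^ m) / 2) := by gcongr
        _ = _ := by ring

/-- Truncation at zero is harmless for `m ≥ 2`: if the kink lies within reach of the step, so that
`A < h`, the lower term vanishes and the upper one is at most `U^(m-2) (2h)²`. -/
theorem second_difference_posPart_pow_le {m : ℕ} (hm : 2 ≤ m) {A h U : ℝ} (hh : 0 ≤ h)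
    (hA : max A 0 + h ≤ U) :
    (((max (A + h) 0) ^ m + (max (A - h) 0) ^ m) / 2 - (max A 0) ^ m) * U ^ 2 ≤
      m ^ 2 * h ^ 2 * U ^ m := by
  have hU0 : 0 ≤ U := by linarith [le_max_right A 0]
  rcases le_or_gt h A with hle | hlt
  · rw [max_eq_left (by linarith), max_eq_left (by linarith), max_eq_left (by linarith)]
    rw [max_eq_left (by linarith)] at hA
    exact (second_difference_pow_le m hh hle hA).1
  · rw [max_eq_right (a := A - h) (by linarith), zero_pow (by omega)]
    obtain ⟨k, rfl⟩ : ∃ k, m = k + 2 := ⟨m - 2, by omega⟩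
    rcases le_or_gt (A + h) 0 with h0 | h0
    · rw [max_eq_right h0, zero_pow (by omega)]
      have : 0 ≤ max A 0 := le_max_right _ _
      have h2 : ((0 + 0) / 2 - max A 0 ^ (k + 2)) * U ^ 2 ≤ 0 := by
        apply mul_nonpos_of_nonpos_of_nonneg _ (by positivity)
        have : 0 ≤ max A 0 ^ (k + 2) := by positivity
        linarith
      exact h2.trans (by positivity)
    · rw [max_eq_left h0.le]
      have h3 : A + h ≤ U := by linarith [le_max_left A 0]
      have h4 : (A + h) ^ (k + 2) ≤ U ^ k * (2 * h) ^ 2 := by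
        rw [pow_add]; gcongr; linarith
      have h5 : 0 ≤ max A 0 ^ (k + 2) := by have := le_max_right A 0; positivity
      have hk : (2 : ℝ) ≤ ((k + 2 : ℕ) : ℝ) ^ 2 := by push_cast; nlinarith [Nat.cast_nonneg (α := ℝ) k]
      calc (((A + h) ^ (k + 2) + 0) / 2 - max A 0 ^ (k + 2)) * U ^ 2
          ≤ (U ^ k * (2 * h) ^ 2 / 2) * U ^ 2 := by gcongr; linarith
        _ = 2 * (h ^ 2 * U ^ (k + 2)) := by ring
        _ ≤ ((k + 2 : ℕ) : ℝ) ^ 2 * (h ^ 2 * U ^ (k + 2)) := by gcongr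
        _ = _ := by ring

/-- When `X` dominates the quadratic variation, the drift `-κ Y` pays for the convexity gain: the
decrease gives a factor `exp (-8 m² Y / A)`, and averaging over the sign gains at most `exp (8 m² Y
/ A)`. -/
theorem truncated_pow_step_of_le {m : ℕ} (hm : 2 ≤ m) {X t Y z κ : ℝ} (hκ : κ = 8 * m + 1)
    (hX : 0 ≤ X) (ht : 0 ≤ t) (hY : 0 ≤ Y) (hz : z ^ 2 ≤ X * Y) (hc : 2 * κ * (t + Y) ≤ X) :
    ((max (X + Y + 2 * z - κ * (t + Y)) 0) ^ m + (max (X + Y - 2 * z - κ * (t + Y)) 0) ^ m) / 2 ≤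
      (max (X - κ * t) 0) ^ m + (10 * κ) ^ m * ((t + Y) ^ m - t ^ m) := by
  have hm' : (2 : ℝ) ≤ m := by exact_mod_cast hm
  have hκ0 : 17 ≤ κ := by linarith
  have hpow : t ^ m ≤ (t + Y) ^ m := by gcongr; linarith
  rcases hX.eq_or_lt with hX0 | hX0
  · subst hX0
    have h1 : t + Y = 0 := by nlinarith
    have h2 : t = 0 := by linarith
    have h3 : Y = 0 := by linarith
    subst h2 h3
    have : z = 0 := by nlinarith
    subst this
    simp
  set B := X + Y - κ * (t + Y) with hBdef
  have hB : X / 2 ≤ B := by rw [hBdef]; nlinarith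
  have hB0 : 0 < B := by linarith
  have hYX : 34 * Y ≤ X := by nlinarith
  have hzB : |2 * z| ≤ B := by
    apply abs_le_of_sq_le_sq _ hB0.le
    nlinarith
  obtain ⟨hz1, hz2⟩ := abs_le.1 hzB
  have e1 : X + Y + 2 * z - κ * (t + Y) = B + 2 * z := by rw [hBdef]; ring
  have e2 : X + Y - 2 * z - κ * (t + Y) = B - 2 * z := by rw [hBdef]; ring
  rw [e1, e2, max_eq_left (by linarith), max_eq_left (by linarith)]
  have h1 := average_pow_le_exp (m := m) hB0 hzB
  have hA0 : 0 < X - κ * t := by nlinarith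
  set A := X - κ * t with hAdef
  -- The `1` in `κ = 8 m + 1` cancels the `+ Y` that comes from `‖x + y‖²`.
  have hBA : B = A - 8 * m * Y := by rw [hBdef, hAdef, hκ]; ring
  have hAX : A ≤ X := by rw [hAdef]; nlinarith
  have h2 : B ≤ A * Real.exp (-(8 * m * Y / A)) := by
    have := Real.add_one_le_exp (-(8 * m * Y / A))
    calc B = A * (-(8 * m * Y / A) + 1) := by rw [hBA]; field_simp; ring
      _ ≤ _ := by gcongr
  have h3 : B ^ m ≤ A ^ m * Real.exp (-(8 * m ^ 2 * Y / A)) := by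
    calc B ^ m ≤ (A * Real.exp (-(8 * m * Y / A))) ^ m := by gcongr
      _ = _ := by rw [mul_pow, ← Real.exp_nat_mul]; ring_nf
  have h4 : (m : ℝ) ^ 2 * (2 * z) ^ 2 / (2 * B ^ 2) ≤ 8 * m ^ 2 * Y / A := by
    rw [div_le_div_iff₀ (by positivity) hA0]
    have hB2 : X ^ 2 / 4 ≤ B ^ 2 := by nlinarith
    calc (m : ℝ) ^ 2 * (2 * z) ^ 2 * A = 4 * m ^ 2 * (z ^ 2 * A) := by ring
      _ ≤ 4 * m ^ 2 * (X * Y * X) := by gcongr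
      _ = 8 * m ^ 2 * Y * (2 * (X ^ 2 / 4)) := by ring
      _ ≤ 8 * m ^ 2 * Y * (2 * B ^ 2) := by gcongr
  have h5 : B ^ m * Real.exp ((m : ℝ) ^ 2 * (2 * z) ^ 2 / (2 * B ^ 2)) ≤ A ^ m := by
    calc B ^ m * Real.exp ((m : ℝ) ^ 2 * (2 * z) ^ 2 / (2 * B ^ 2))
        ≤ A ^ m * Real.exp (-(8 * m ^ 2 * Y / A)) * Real.exp (8 * m ^ 2 * Y / A) := by gcongr
      _ = A ^ m := by rw [mul_assoc, ← Real.exp_add]; simp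
  rw [max_eq_left hA0.le]
  have h6 : 0 ≤ (10 * κ) ^ m * ((t + Y) ^ m - t ^ m) := by
    apply mul_nonneg (by positivity); linarith
  linarith

/-- When `X` is at most a multiple of the quadratic variation `T = t + Y`, everything has size `κ
T`. The second difference is then controlled by `Y T^(m-1)`, which the increment `T^m - t^m` of the
compensator absorbs. -/
theorem truncated_pow_step_of_lt {m : ℕ} (hm : 2 ≤ m) {X t Y z κ : ℝ} (hκ : κ = 8 * m + 1)
    (hX : 0 ≤ X) (ht : 0 ≤ t) (hY : 0 ≤ Y) (hz : z ^ 2 ≤ X * Y) (hc : X < 2 * κ * (t + Y)) :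
    ((max (X + Y + 2 * z - κ * (t + Y)) 0) ^ m + (max (X + Y - 2 * z - κ * (t + Y)) 0) ^ m) / 2 ≤
      (max (X - κ * t) 0) ^ m + (10 * κ) ^ m * ((t + Y) ^ m - t ^ m) := by
  have hm' : (2 : ℝ) ≤ m := by exact_mod_cast hm
  have hκ0 : 17 ≤ κ := by linarith
  have hT : 0 < t + Y := by
    by_contra hcon
    have : t + Y = 0 := by linarith
    rw [this] at hc; linarith
  set T := t + Y with hTdef
  set h := 2 * |z| with hhdef
  have hh0 : 0 ≤ h := by positivity
  have hsq : h ^ 2 ≤ 8 * κ * T * Y := by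
    rw [hhdef, mul_pow, sq_abs]; nlinarith
  have hAB : X + Y - κ * T ≤ X - κ * t := by rw [hTdef]; nlinarith
  have hsum : (max (X + Y + 2 * z - κ * T) 0) ^ m + (max (X + Y - 2 * z - κ * T) 0) ^ m ≤
      (max (X - κ * t + h) 0) ^ m + (max (X - κ * t - h) 0) ^ m := by
    rcases abs_cases z with ⟨hz1, _⟩ | ⟨hz1, _⟩
    · refine add_le_add (pow_le_pow_left₀ (le_max_right _ _) (max_le_max_right 0 ?_) m)
        (pow_le_pow_left₀ (le_max_right _ _) (max_le_max_right 0 ?_) m) <;> linarith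
    · rw [add_comm]
      refine add_le_add (pow_le_pow_left₀ (le_max_right _ _) (max_le_max_right 0 ?_) m)
        (pow_le_pow_left₀ (le_max_right _ _) (max_le_max_right 0 ?_) m) <;> linarith
  have hAX : max (X - κ * t) 0 ≤ X := max_le (by nlinarith) hX
  have hhX : h ≤ X + Y := by
    refine (sq_le_sq₀ hh0 (by positivity)).1 ?_
    rw [hhdef, mul_pow, sq_abs]; nlinarith [sq_nonneg (X - Y)]
  -- Here `max (X - κ t) 0 ≤ X < 2 κ T` and `h ≤ X + Y ≤ 3 κ T`.
  set U := 5 * κ * T with hUdef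
  have hU : max (X - κ * t) 0 + h ≤ U := by rw [hUdef]; nlinarith
  have hU0 : 0 < U := by positivity
  have h1 := second_difference_posPart_pow_le hm hh0 hU
  have h2 : ((max (X - κ * t + h) 0) ^ m + (max (X - κ * t - h) 0) ^ m) / 2 -
      (max (X - κ * t) 0) ^ m ≤ m * (5 * κ) ^ m * (Y * T ^ (m - 1)) := by
    rw [← mul_le_mul_iff_left₀ (show 0 < U ^ 2 by positivity)]
    refine h1.trans ?_
    have hTm : T ^ m = T ^ (m - 1) * T := by rw [← pow_succ]; congr 1; omega
    have hUm : U ^ m = (5 * κ) ^ m * (T ^ (m - 1) * T) := by rw [hUdef, mul_pow, hTm]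
    rw [hUm]
    have hmκ : 8 * m * κ ≤ 25 * κ ^ 2 := by nlinarith
    calc (m : ℝ) ^ 2 * h ^ 2 * ((5 * κ) ^ m * (T ^ (m - 1) * T))
        ≤ (m : ℝ) ^ 2 * (8 * κ * T * Y) * ((5 * κ) ^ m * (T ^ (m - 1) * T)) := by gcongr
      _ = (m * (5 * κ) ^ m * (Y * T ^ (m - 1))) * (T ^ 2 * (8 * m * κ)) := by ring
      _ ≤ (m * (5 * κ) ^ m * (Y * T ^ (m - 1))) * (T ^ 2 * (25 * κ ^ 2)) := by
        gcongr
      _ = _ := by rw [hUdef]; ring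
  have h3 : Y * T ^ (m - 1) ≤ T ^ m - t ^ m := by
    have hTm : T ^ m = T * T ^ (m - 1) := by rw [← pow_succ']; congr 1; omega
    have htm : t ^ m = t * t ^ (m - 1) := by rw [← pow_succ']; congr 1; omega
    have h7 : t ^ (m - 1) ≤ T ^ (m - 1) := by gcongr; linarith
    rw [hTm, htm]
    nlinarith
  have h4 : (m : ℝ) * (5 * κ) ^ m ≤ (10 * κ) ^ m := by
    have : (m : ℝ) ≤ 2 ^ m := by exact_mod_cast Nat.lt_two_pow_self.le
    calc (m : ℝ) * (5 * κ) ^ m ≤ 2 ^ m * (5 * κ) ^ m := by gcongr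
      _ = _ := by rw [← mul_pow]; ring_nf
  have h5 : m * (5 * κ) ^ m * (Y * T ^ (m - 1)) ≤ (10 * κ) ^ m * (T ^ m - t ^ m) :=
    mul_le_mul h4 h3 (by positivity) (by positivity)
  linarith

/-- One step of a conditionally symmetric martingale does not increase the compensated
truncated power, in terms of `X = ‖x‖²`, `t`, the quadratic variation so far, `Y = ‖y‖²` for the
increment `y`, and `z = ⟪x, y⟫`. -/
theorem truncated_pow_step {m : ℕ} (hm : 2 ≤ m) {X t Y z κ : ℝ} (hκ : κ = 8 * m + 1)
    (hX : 0 ≤ X) (ht : 0 ≤ t) (hY : 0 ≤ Y) (hz : z ^ 2 ≤ X * Y) :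
    ((max (X + Y + 2 * z - κ * (t + Y)) 0) ^ m + (max (X + Y - 2 * z - κ * (t + Y)) 0) ^ m) / 2 ≤
      (max (X - κ * t) 0) ^ m + (10 * κ) ^ m * ((t + Y) ^ m - t ^ m) := by
  rcases le_or_gt (2 * κ * (t + Y)) X with hc | hc
  · exact truncated_pow_step_of_le hm hκ hX ht hY hz hc
  · exact truncated_pow_step_of_lt hm hκ hX ht hY hz hc

/-- Square function inequality with the optimal order of the constant, for sums of Hilbert space
valued functions each of which is odd under a bijection that fixes the preceding ones. -/
theorem sum_norm_pow_le_square_function {Ω H : Type*} [Fintype Ω] [NormedAddCommGroup H]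
    [InnerProductSpace ℝ H] {m : ℕ} (hm : 2 ≤ m) (N : ℕ) (D : ℕ → Ω → H) (τ : ℕ → Ω ≃ Ω)
    (hfix : ∀ c < N, ∀ c' < c, ∀ ω, D c' (τ c ω) = D c' ω)
    (hodd : ∀ c < N, ∀ ω, D c (τ c ω) = -D c ω) :
    ∑ ω, ‖∑ c ∈ Finset.range N, D c ω‖ ^ (2 * m) ≤
      (360 * m : ℝ) ^ m * ∑ ω, (∑ c ∈ Finset.range N, ‖D c ω‖ ^ 2) ^ m := by
  have hm' : (2 : ℝ) ≤ m := by exact_mod_cast hm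
  set κ : ℝ := 8 * m + 1 with hκ
  have hκ0 : 0 ≤ κ := by positivity
  set f : ℕ → Ω → H := fun j ω => ∑ c ∈ Finset.range j, D c ω with hf
  set s : ℕ → Ω → ℝ := fun j ω => ∑ c ∈ Finset.range j, ‖D c ω‖ ^ 2 with hs
  have hs0 : ∀ j ω, 0 ≤ s j ω := fun j ω => Finset.sum_nonneg fun _ _ => by positivity
  -- The truncated power measures the excess of `‖f_j‖²` over `κ s_j`; its total grows by no more
  -- than the compensator does.
  have main : ∀ j ≤ N, ∑ ω, (max (‖f j ω‖ ^ 2 - κ * s j ω) 0) ^ m ≤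
      ∑ ω, (10 * κ) ^ m * s j ω ^ m := by
    intro j
    induction j with
    | zero => intro _; simp [hf, hs, show m ≠ 0 by omega]
    | succ j ih =>
      intro hj
      have ih := ih (by omega)
      have hfτ : ∀ ω, f j (τ j ω) = f j ω := fun ω =>
        Finset.sum_congr rfl fun c hc => hfix j hj c (Finset.mem_range.1 hc) ω
      have hsτ : ∀ ω, s j (τ j ω) = s j ω := fun ω =>
        Finset.sum_congr rfl fun c hc => by rw [hfix j hj c (Finset.mem_range.1 hc) ω]
      have hf1 : ∀ ω, f (j + 1) ω = f j ω + D j ω := fun ω => Finset.sum_range_succ _ _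
      have hs1 : ∀ ω, s (j + 1) ω = s j ω + ‖D j ω‖ ^ 2 := fun ω => Finset.sum_range_succ _ _
      -- Reindexing by `τ j` reverses the increment and keeps the past, so the sum over `Ω` equals
      -- its average over both signs of the increment.
      have hsym : ∑ ω, (max (‖f (j + 1) ω‖ ^ 2 - κ * s (j + 1) ω) 0) ^ m =
          ∑ ω, (max (‖f j ω - D j ω‖ ^ 2 - κ * (s j ω + ‖D j ω‖ ^ 2)) 0) ^ m := by
        rw [← Equiv.sum_comp (τ j)]
        refine Finset.sum_congr rfl fun ω _ => ?_
        rw [hf1, hs1, hfτ, hsτ, hodd j hj, norm_neg, sub_eq_add_neg (f j ω)]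
      have hstep : ∀ ω, ((max (‖f (j + 1) ω‖ ^ 2 - κ * s (j + 1) ω) 0) ^ m +
          (max (‖f j ω - D j ω‖ ^ 2 - κ * (s j ω + ‖D j ω‖ ^ 2)) 0) ^ m) / 2 ≤
          (max (‖f j ω‖ ^ 2 - κ * s j ω) 0) ^ m +
            (10 * κ) ^ m * (s (j + 1) ω ^ m - s j ω ^ m) := by
        intro ω
        have h := truncated_pow_step hm (X := ‖f j ω‖ ^ 2) (t := s j ω) (Y := ‖D j ω‖ ^ 2)
          (z := inner ℝ (f j ω) (D j ω)) hκ (by positivity) (hs0 j ω) (by positivity) (by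
            rw [← mul_pow, ← sq_abs]
            gcongr
            exact abs_real_inner_le_norm _ _)
        rw [hf1, hs1, norm_add_sq_real, norm_sub_sq_real]
        convert h using 6 <;> ring
      have hsum := Finset.sum_le_sum fun ω (_ : ω ∈ Finset.univ) => hstep ω
      rw [← Finset.sum_div, Finset.sum_add_distrib, ← hsym, Finset.sum_add_distrib] at hsum
      have h3 : ∑ ω, (10 * κ) ^ m * (s (j + 1) ω ^ m - s j ω ^ m) =
          ∑ ω, (10 * κ) ^ m * s (j + 1) ω ^ m - ∑ ω, (10 * κ) ^ m * s j ω ^ m := by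
        rw [← Finset.sum_sub_distrib]
        exact Finset.sum_congr rfl fun ω _ => by ring
      linarith
  have hN := main N le_rfl
  rw [Finset.mul_sum]
  calc ∑ ω, ‖f N ω‖ ^ (2 * m)
      ≤ ∑ ω, 2 ^ m * ((max (‖f N ω‖ ^ 2 - κ * s N ω) 0) ^ m + (κ * s N ω) ^ m) := by
        refine Finset.sum_le_sum fun ω _ => ?_
        have h0 := hs0 N ω
        have h1 : ‖f N ω‖ ^ 2 ≤ max (‖f N ω‖ ^ 2 - κ * s N ω) 0 + κ * s N ω := by
          linarith [le_max_left (‖f N ω‖ ^ 2 - κ * s N ω) 0]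
        calc ‖f N ω‖ ^ (2 * m) = (‖f N ω‖ ^ 2) ^ m := pow_mul _ _ _
          _ ≤ (max (‖f N ω‖ ^ 2 - κ * s N ω) 0 + κ * s N ω) ^ m := by gcongr
          _ ≤ 2 ^ (m - 1) * ((max (‖f N ω‖ ^ 2 - κ * s N ω) 0) ^ m + (κ * s N ω) ^ m) :=
            add_pow_le (le_max_right _ _) (by positivity) m
          _ ≤ _ := by
            gcongr
            · norm_num
            · omega
    _ ≤ ∑ ω, 2 ^ m * ((10 * κ) ^ m * s N ω ^ m + (κ * s N ω) ^ m) := by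
        rw [← Finset.mul_sum, ← Finset.mul_sum, Finset.sum_add_distrib, Finset.sum_add_distrib]
        gcongr
    _ ≤ ∑ ω, (360 * m : ℝ) ^ m * s N ω ^ m := by
        refine Finset.sum_le_sum fun ω _ => ?_
        have h0 := hs0 N ω
        have h1 : κ ^ m ≤ (10 * κ) ^ m := by gcongr; linarith
        have h2 : (2 : ℝ) ≤ 2 ^ m := le_self_pow₀ (by norm_num) (by omega)
        -- Source of the constant: `40 κ = 320 m + 40`.
        have h3 : 40 * κ ≤ 360 * m := by linarith
        calc 2 ^ m * ((10 * κ) ^ m * s N ω ^ m + (κ * s N ω) ^ m)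
            = 2 ^ m * ((10 * κ) ^ m + κ ^ m) * s N ω ^ m := by rw [mul_pow κ]; ring
          _ ≤ 2 ^ m * ((10 * κ) ^ m + (10 * κ) ^ m) * s N ω ^ m := by gcongr
          _ = 2 * (2 ^ m * (10 * κ) ^ m * s N ω ^ m) := by ring
          _ ≤ 2 ^ m * (2 ^ m * (10 * κ) ^ m * s N ω ^ m) := by gcongr
          _ = (40 * κ) ^ m * s N ω ^ m := by
            rw [← mul_assoc, ← mul_assoc, ← mul_pow, ← mul_pow]; ring_nf
          _ ≤ _ := mul_le_mul_of_nonneg_right (pow_le_pow_left₀ (by positivity) h3 m)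
            (by positivity)

/-! ### Moment norms on a finite uniform space -/

/-- The normalized `L^{2m}` norm of a function on a finite set. -/
noncomputable def momentNorm {Ω : Type*} [Fintype Ω] (m : ℕ) (g : Ω → ℝ) : ℝ :=
  ((∑ ω, |g ω| ^ (2 * m)) / Fintype.card Ω) ^ (1 / (2 * m : ℝ))

section momentNorm

variable {Ω : Type*} [Fintype Ω]

theorem momentNorm_nonneg (m : ℕ) (g : Ω → ℝ) : 0 ≤ momentNorm m g := by
  unfold momentNorm; positivity

theorem momentNorm_pow {m : ℕ} (hm : 1 ≤ m) (g : Ω → ℝ) :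
    momentNorm m g ^ (2 * m) = (∑ ω, |g ω| ^ (2 * m)) / Fintype.card Ω := by
  have hm' : (m : ℝ) ≠ 0 := by positivity
  unfold momentNorm
  rw [← Real.rpow_natCast, ← Real.rpow_mul (by positivity)]
  push_cast
  rw [one_div_mul_cancel (by positivity), Real.rpow_one]

theorem momentNorm_le_of_pow_le {m : ℕ} (hm : 1 ≤ m) {g : Ω → ℝ} {a : ℝ} (ha : 0 ≤ a)
    (h : (∑ ω, |g ω| ^ (2 * m)) / Fintype.card Ω ≤ a ^ (2 * m)) : momentNorm m g ≤ a := by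
  rw [← momentNorm_pow hm] at h
  exact le_of_pow_le_pow_left₀ (by omega) ha h

theorem momentNorm_mono {m : ℕ} (hm : 1 ≤ m) {g h : Ω → ℝ} (hgh : ∀ ω, |g ω| ≤ |h ω|) :
    momentNorm m g ≤ momentNorm m h := by
  refine momentNorm_le_of_pow_le hm (momentNorm_nonneg m h) ?_
  rw [momentNorm_pow hm]
  gcongr ?_ / _
  exact Finset.sum_le_sum fun ω _ => pow_le_pow_left₀ (abs_nonneg _) (hgh ω) _

theorem momentNorm_le_of_abs_le [Nonempty Ω] {m : ℕ} (hm : 1 ≤ m) {g : Ω → ℝ} {a : ℝ}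
    (h : ∀ ω, |g ω| ≤ a) : momentNorm m g ≤ a := by
  have ha : 0 ≤ a := (abs_nonneg _).trans (h (Classical.arbitrary Ω))
  refine momentNorm_le_of_pow_le hm ha ?_
  rw [div_le_iff₀ (by exact_mod_cast Fintype.card_pos)]
  calc ∑ ω, |g ω| ^ (2 * m) ≤ ∑ _ω : Ω, a ^ (2 * m) := by gcongr with ω; exact h ω
    _ = _ := by simp [mul_comm]

theorem momentNorm_add_le {m : ℕ} (hm : 1 ≤ m) (g h : Ω → ℝ) :
    momentNorm m (fun ω => g ω + h ω) ≤ momentNorm m g + momentNorm m h := by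
  have hm' : (1 : ℝ) ≤ m := by exact_mod_cast hm
  have key := Real.Lp_add_le Finset.univ g h (p := 2 * m) (by linarith)
  have e : ∀ u : Ω → ℝ, momentNorm m u =
      (∑ ω, |u ω| ^ (2 * m : ℝ)) ^ (1 / (2 * m : ℝ)) *
        ((Fintype.card Ω : ℝ)⁻¹) ^ (1 / (2 * m : ℝ)) := by
    intro u
    unfold momentNorm
    rw [div_eq_mul_inv, Real.mul_rpow (by positivity) (by positivity)]
    congr 2
    refine Finset.sum_congr rfl fun ω _ => ?_
    rw [← Real.rpow_natCast]; push_cast; rfl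
  rw [e, e, e, ← add_mul]
  gcongr

/-- Cauchy-Schwarz: the `L^m` norm of a product is at most the product of the `L^{2m}` norms. -/
theorem sum_abs_mul_pow_le {m : ℕ} (hm : 1 ≤ m) (g h : Ω → ℝ) :
    (∑ ω, |g ω * h ω| ^ m) / Fintype.card Ω ≤ (momentNorm m g * momentNorm m h) ^ m := by
  have h0 := momentNorm_nonneg m g
  have h1 := momentNorm_nonneg m h
  refine (sq_le_sq₀ (by positivity) (by positivity)).1 ?_
  rw [← pow_mul, mul_comm m 2, mul_pow, momentNorm_pow hm, momentNorm_pow hm, div_pow,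
    div_mul_div_comm, ← sq]
  gcongr
  have := Finset.sum_mul_sq_le_sq_mul_sq Finset.univ (fun ω => |g ω| ^ m) (fun ω => |h ω| ^ m)
  simp only [← mul_pow, ← abs_mul, ← pow_mul, mul_comm m 2] at this
  exact this

/-- The square function inequality for finite families, in the form used for the estimates of
correlations: the square function is bounded by a product. -/
theorem momentNorm_sq_le_of_square_function {ι : Type*} [Fintype ι] {m : ℕ} (hm : 2 ≤ m)
    (N : ℕ) (D : ℕ → ι → Ω → ℝ) (τ : ℕ → Ω ≃ Ω)
    (hfix : ∀ c < N, ∀ c' < c, ∀ i ω, D c' i (τ c ω) = D c' i ω)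
    (hodd : ∀ c < N, ∀ i ω, D c i (τ c ω) = -D c i ω)
    (E g h : Ω → ℝ) (hE : ∀ ω, E ω ^ 2 ≤ ∑ i, (∑ c ∈ Finset.range N, D c i ω) ^ 2)
    (hgh : ∀ ω, ∑ c ∈ Finset.range N, ∑ i, D c i ω ^ 2 ≤ g ω * h ω) :
    momentNorm m E ^ 2 ≤ 360 * m * (momentNorm m g * momentNorm m h) := by
  have hg0 := momentNorm_nonneg m g
  have hh0 := momentNorm_nonneg m h
  have hE0 := momentNorm_nonneg m E
  -- Treating the whole family as one Euclidean-valued martingale keeps the constant independent of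
  -- the number of indices `i`.
  set D' : ℕ → Ω → EuclideanSpace ℝ ι := fun c ω => WithLp.toLp 2 (fun i => D c i ω) with hD'
  have key := sum_norm_pow_le_square_function hm N D' τ
    (fun c hc c' hc' ω => by ext i; exact hfix c hc c' hc' i ω)
    (fun c hc ω => by ext i; exact hodd c hc i ω)
  have hn : ∀ ω, ‖∑ c ∈ Finset.range N, D' c ω‖ ^ 2 = ∑ i, (∑ c ∈ Finset.range N, D c i ω) ^ 2 := by
    intro ω
    rw [EuclideanSpace.real_norm_sq_eq]
    refine Finset.sum_congr rfl fun i _ => ?_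
    simp [hD']
  have hn2 : ∀ ω, ∑ c ∈ Finset.range N, ‖D' c ω‖ ^ 2 ≤ g ω * h ω := by
    intro ω
    refine le_trans (le_of_eq (Finset.sum_congr rfl fun c _ => ?_)) (hgh ω)
    rw [EuclideanSpace.real_norm_sq_eq]
  refine le_of_pow_le_pow_left₀ (n := m) (by omega) (by positivity) ?_
  rw [← pow_mul, momentNorm_pow (by omega), mul_pow]
  refine le_trans ?_ (mul_le_mul_of_nonneg_left (sum_abs_mul_pow_le (by omega) g h) (by positivity))
  rw [← mul_div_assoc]
  gcongr
  calc ∑ ω, |E ω| ^ (2 * m) ≤ ∑ ω, ‖∑ c ∈ Finset.range N, D' c ω‖ ^ (2 * m) := by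
        gcongr with ω
        exact abs_le_of_sq_le_sq (by rw [hn]; exact hE ω) (norm_nonneg _)
    _ ≤ (360 * m : ℝ) ^ m * ∑ ω, (∑ c ∈ Finset.range N, ‖D' c ω‖ ^ 2) ^ m := key
    _ ≤ _ := by
        gcongr with ω
        exact (hn2 ω).trans (le_abs_self _)

end momentNorm

/-! ### Gram matrices and their Hilbert-Schmidt norms -/

section Gram

variable {ι ι' V A : Type*} [Fintype V] [Fintype A]

/-- The trace of a product of two Gram matrices is a sum of squares. This gives both its
nonnegativity and the passage between square functions and traces. -/
theorem sum_gram_mul_gram (R : Finset ι) (R' : Finset ι') (x : ι → V → ℝ) (y : ι' → V → ℝ) :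
    ∑ v, ∑ v', (∑ ρ ∈ R, x ρ v * x ρ v') * (∑ ρ' ∈ R', y ρ' v * y ρ' v') =
      ∑ ρ ∈ R, ∑ ρ' ∈ R', (∑ v, x ρ v * y ρ' v) ^ 2 := by
  have h : ∀ ρ ∈ R, ∀ ρ' ∈ R', (∑ v, x ρ v * y ρ' v) ^ 2 =
      ∑ v, ∑ v', (x ρ v * x ρ v') * (y ρ' v * y ρ' v') := by
    intro ρ _ ρ' _
    rw [sq, Finset.sum_mul_sum]
    exact Finset.sum_congr rfl fun v _ => Finset.sum_congr rfl fun v' _ => by ring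
  rw [Finset.sum_congr rfl fun ρ hρ => Finset.sum_congr rfl fun ρ' hρ' => h ρ hρ ρ' hρ']
  simp_rw [Finset.sum_mul_sum]
  calc ∑ v, ∑ v', ∑ ρ ∈ R, ∑ ρ' ∈ R', (x ρ v * x ρ v') * (y ρ' v * y ρ' v')
      = ∑ v, ∑ ρ ∈ R, ∑ v', ∑ ρ' ∈ R', (x ρ v * x ρ v') * (y ρ' v * y ρ' v') :=
        Finset.sum_congr rfl fun v _ => Finset.sum_comm
    _ = ∑ ρ ∈ R, ∑ v, ∑ v', ∑ ρ' ∈ R', (x ρ v * x ρ v') * (y ρ' v * y ρ' v') := Finset.sum_comm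
    _ = ∑ ρ ∈ R, ∑ v, ∑ ρ' ∈ R', ∑ v', (x ρ v * x ρ v') * (y ρ' v * y ρ' v') :=
        Finset.sum_congr rfl fun ρ _ => Finset.sum_congr rfl fun v _ => Finset.sum_comm
    _ = _ := Finset.sum_congr rfl fun ρ _ => Finset.sum_comm

/-- The squared Hilbert-Schmidt norms of the Gram matrices of disjoint parts add up to at most that
of the whole Gram matrix. -/
theorem sum_gram_sq_le (s : Finset ℕ) (R : ℕ → Finset ι) (x : ℕ → ι → V → ℝ) :
    ∑ j ∈ s, ∑ v, ∑ v', (∑ ρ ∈ R j, x j ρ v * x j ρ v') ^ 2 ≤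
      ∑ v, ∑ v', (∑ j ∈ s, ∑ ρ ∈ R j, x j ρ v * x j ρ v') ^ 2 := by
  have h1 : ∑ v, ∑ v', (∑ j ∈ s, ∑ ρ ∈ R j, x j ρ v * x j ρ v') ^ 2 =
      ∑ j ∈ s, ∑ k ∈ s, ∑ v, ∑ v', (∑ ρ ∈ R j, x j ρ v * x j ρ v') *
        (∑ ρ ∈ R k, x k ρ v * x k ρ v') := by
    simp_rw [sq, Finset.sum_mul_sum s s]
    rw [Finset.sum_congr rfl fun v _ => Finset.sum_comm]
    rw [Finset.sum_comm]
    refine Finset.sum_congr rfl fun j _ => ?_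
    rw [Finset.sum_congr rfl fun v _ => Finset.sum_comm]
    rw [Finset.sum_comm]
  rw [h1]
  -- Only the diagonal terms of the double sum are kept; the others are traces of products of
  -- positive semidefinite matrices.
  refine Finset.sum_le_sum fun j hj => ?_
  refine le_trans (le_of_eq ?_) (Finset.single_le_sum (f := fun k => ∑ v, ∑ v',
    (∑ ρ ∈ R j, x j ρ v * x j ρ v') * (∑ ρ ∈ R k, x k ρ v * x k ρ v')) (fun k _ => ?_) hj)
  · simp_rw [sq]
  · rw [sum_gram_mul_gram]
    positivity

/-- The Hilbert-Schmidt norm of the Gram matrix of the columns of `G`. -/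
noncomputable def gramNorm (G : V → A → ℝ) : ℝ :=
  √(∑ a, ∑ a', (∑ v, G v a * G v a') ^ 2)

theorem gramNorm_nonneg (G : V → A → ℝ) : 0 ≤ gramNorm G := Real.sqrt_nonneg _

theorem gramNorm_sq (G : V → A → ℝ) :
    gramNorm G ^ 2 = ∑ a, ∑ a', (∑ v, G v a * G v a') ^ 2 :=
  Real.sq_sqrt (by positivity)

/-- The matrices `GᵀG` and `GGᵀ` have the same Hilbert-Schmidt norm. -/
theorem gramNorm_swap (G : V → A → ℝ) : gramNorm (fun a v => G v a) = gramNorm G := by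
  unfold gramNorm
  congr 1
  rw [← sum_gram_mul_gram Finset.univ Finset.univ (fun a v => G v a) (fun a v => G v a)]
  simp_rw [sq]

theorem sqrt_sum_add_sq_le (x y : A → ℝ) :
    √(∑ i, (x i + y i) ^ 2) ≤ √(∑ i, x i ^ 2) + √(∑ i, y i ^ 2) := by
  have := norm_add_le (WithLp.toLp 2 x : EuclideanSpace ℝ A) (WithLp.toLp 2 y)
  simpa [EuclideanSpace.norm_eq] using this

end Gram

/-! ### Dyadic merging of slices into blocks -/

theorem sum_range_mul_eq_sum_blocks (φ : ℕ → ℝ) (w n : ℕ) :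
    ∑ c ∈ Finset.range (n * w), φ c =
      ∑ i ∈ Finset.range n, ∑ c ∈ Finset.Ico (i * w) ((i + 1) * w), φ c := by
  induction n with
  | zero => simp
  | succ n ih =>
    rw [Finset.sum_range_succ, ← ih, Finset.range_eq_Ico, Finset.range_eq_Ico,
      Finset.sum_Ico_consecutive _ (Nat.zero_le _)
      (Nat.mul_le_mul_right _ (by omega))]

theorem sum_range_two_mul (φ : ℕ → ℝ) (n : ℕ) :
    ∑ i ∈ Finset.range (2 * n), φ i =
      ∑ i ∈ Finset.range n, (φ (2 * i) + φ (2 * i + 1)) := by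
  induction n with
  | zero => simp
  | succ n ih =>
    rw [show 2 * (n + 1) = 2 * n + 1 + 1 by ring, Finset.sum_range_succ, Finset.sum_range_succ, ih,
      Finset.sum_range_succ]
    ring

section Blocks

variable {V A : Type*}

/-- The sum of the slices `X v a c` over the `i`-th block of length `w`. -/
def blockPart (X : V → A → ℕ → ℝ) (w i : ℕ) (v : V) (a : A) : ℝ :=
  ∑ c ∈ Finset.Ico (i * w) ((i + 1) * w), X v a c

theorem blockPart_two_mul (X : V → A → ℕ → ℝ) (w i : ℕ) (v : V) (a : A) :
    blockPart X (2 * w) i v a = blockPart X w (2 * i) v a + blockPart X w (2 * i + 1) v a := by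
  unfold blockPart
  rw [Finset.sum_Ico_consecutive _ (Nat.mul_le_mul_right _ (by omega))
    (Nat.mul_le_mul_right _ (by omega))]
  congr 2 <;> ring

variable [Fintype V]

/-- The correlation of a slice in an odd block with the preceding block. -/
def siblingTerm (X : V → A → ℕ → ℝ) (w c : ℕ) (p : A × A) : ℝ :=
  if c / w % 2 = 1 then ∑ v, X v p.1 c * blockPart X w (c / w - 1) v p.2 else 0

/-- Used with `φ` the identity for the cross term of a merge, and with `φ` the square for its square
function. -/
theorem sum_siblingTerm (φ : ℝ → ℝ) (hφ : φ 0 = 0) (X : V → A → ℕ → ℝ) {w : ℕ}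
    (n : ℕ) (p : A × A) :
    ∑ c ∈ Finset.range (2 * n * w), φ (siblingTerm X w c p) =
      ∑ i ∈ Finset.range n, ∑ c ∈ Finset.Ico ((2 * i + 1) * w) ((2 * i + 1 + 1) * w),
        φ (∑ v, X v p.1 c * blockPart X w (2 * i) v p.2) := by
  rw [sum_range_mul_eq_sum_blocks, sum_range_two_mul]
  refine Finset.sum_congr rfl fun i _ => ?_
  have hdiv : ∀ j, ∀ c ∈ Finset.Ico (j * w) ((j + 1) * w), c / w = j := by
    intro j c hc
    rw [Finset.mem_Ico] at hc
    exact Nat.div_eq_of_lt_le hc.1 hc.2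
  have h1 : ∑ c ∈ Finset.Ico (2 * i * w) ((2 * i + 1) * w), φ (siblingTerm X w c p) = 0 := by
    refine Finset.sum_eq_zero fun c hc => ?_
    rw [siblingTerm, hdiv _ c hc, if_neg (by omega), hφ]
  rw [h1, zero_add]
  refine Finset.sum_congr rfl fun c hc => ?_
  rw [siblingTerm, hdiv _ c hc, if_pos (by omega)]
  rfl

variable [Fintype A]

/-- The Hilbert-Schmidt norm of the Gram matrix of the blocks of length `w`, the rows being the
pairs of a row and a block. -/
noncomputable def blockGramNorm (X : V → A → ℕ → ℝ) (w n : ℕ) : ℝ :=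
  √(∑ a, ∑ a', (∑ i ∈ Finset.range n, ∑ v, blockPart X w i v a * blockPart X w i v a') ^ 2)

/-- The Hilbert-Schmidt norm of the Gram matrix of the rows, the columns being the pairs of a
column and a slice. -/
noncomputable def sliceGramNorm (X : V → A → ℕ → ℝ) (N : ℕ) : ℝ :=
  √(∑ v, ∑ v', (∑ c ∈ Finset.range N, ∑ a, X v a c * X v' a c) ^ 2)

/-- Merging neighbours changes the Gram matrix by `e + eᵀ`, where `e` correlates each odd block with
the even block before it; the two have equal norm. -/
theorem blockGramNorm_two_mul_le (X : V → A → ℕ → ℝ) (w n : ℕ) :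
    blockGramNorm X (2 * w) n ≤ blockGramNorm X w (2 * n) +
      2 * √(∑ p, (∑ c ∈ Finset.range (2 * n * w), siblingTerm X w c p) ^ 2) := by
  set e : A → A → ℝ := fun a a' =>
    ∑ i ∈ Finset.range n, ∑ v, blockPart X w (2 * i + 1) v a * blockPart X w (2 * i) v a' with he
  set T : A → A → ℝ := fun a a' =>
    ∑ i ∈ Finset.range (2 * n), ∑ v, blockPart X w i v a * blockPart X w i v a' with hT
  have h1 : ∀ p : A × A, ∑ c ∈ Finset.range (2 * n * w), siblingTerm X w c p = e p.1 p.2 := by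
    intro p
    rw [sum_siblingTerm (fun y => y) rfl X n p, he]
    refine Finset.sum_congr rfl fun i _ => ?_
    rw [Finset.sum_comm]
    refine Finset.sum_congr rfl fun v _ => ?_
    rw [← Finset.sum_mul]
    rfl
  have h2 : ∀ a a', ∑ i ∈ Finset.range n, ∑ v, blockPart X (2 * w) i v a *
      blockPart X (2 * w) i v a' = T a a' + (e a a' + e a' a) := by
    intro a a'
    rw [hT, he]
    simp only []
    rw [sum_range_two_mul, ← Finset.sum_add_distrib, ← Finset.sum_add_distrib]
    refine Finset.sum_congr rfl fun i _ => ?_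
    rw [← Finset.sum_add_distrib, ← Finset.sum_add_distrib, ← Finset.sum_add_distrib]
    refine Finset.sum_congr rfl fun v _ => ?_
    rw [blockPart_two_mul, blockPart_two_mul]
    ring
  simp_rw [h1]
  unfold blockGramNorm
  simp_rw [h2]
  rw [← Fintype.sum_prod_type' (f := fun a a' => (T a a' + (e a a' + e a' a)) ^ 2),
    ← Fintype.sum_prod_type' (f := fun a a' => (T a a') ^ 2)]
  have h3 := sqrt_sum_add_sq_le (fun p : A × A => T p.1 p.2) (fun p => e p.1 p.2 + e p.2 p.1)
  have h4 := sqrt_sum_add_sq_le (fun p : A × A => e p.1 p.2) (fun p => e p.2 p.1)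
  have h5 : ∑ p : A × A, e p.2 p.1 ^ 2 = ∑ p : A × A, e p.1 p.2 ^ 2 :=
    Equiv.sum_comp (Equiv.prodComm A A) (fun p => e p.1 p.2 ^ 2)
  rw [h5] at h4
  linarith

/-- The left side is the sum over `i` of the traces of `P (2 * i + 1)` against `Q (2 * i)`: a row
Gram matrix of slices against one of a block. Cauchy-Schwarz and `sum_gram_sq_le` give the product
of the norms; for `Q` the Gram matrices are first switched from rows to columns. -/
theorem sum_siblingTerm_sq_le (X : V → A → ℕ → ℝ) (w n : ℕ) :
    ∑ c ∈ Finset.range (2 * n * w), ∑ p, siblingTerm X w c p ^ 2 ≤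
      sliceGramNorm X (2 * n * w) * blockGramNorm X w (2 * n) := by
  set J : ℕ → Finset ℕ := fun j => Finset.Ico (j * w) ((j + 1) * w) with hJ
  set P : ℕ → V → V → ℝ := fun j v v' =>
    ∑ ρ ∈ J j ×ˢ (Finset.univ : Finset A), X v ρ.2 ρ.1 * X v' ρ.2 ρ.1 with hP
  set Q : ℕ → V → V → ℝ := fun j v v' =>
    ∑ a, blockPart X w j v a * blockPart X w j v' a with hQ
  have h1 : ∑ c ∈ Finset.range (2 * n * w), ∑ p, siblingTerm X w c p ^ 2 =
      ∑ i ∈ Finset.range n, ∑ v, ∑ v', P (2 * i + 1) v v' * Q (2 * i) v v' := by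
    have h0 := fun p => sum_siblingTerm (fun y => y ^ 2) (by norm_num) X (w := w) n p
    rw [Finset.sum_comm, Finset.sum_congr rfl fun p _ => h0 p, Finset.sum_comm]
    refine Finset.sum_congr rfl fun i _ => ?_
    rw [hP, hQ]
    simp only []
    rw [sum_gram_mul_gram _ Finset.univ (fun (ρ : ℕ × A) v => X v ρ.2 ρ.1)
      (fun a v => blockPart X w (2 * i) v a), Finset.sum_product, Finset.sum_comm]
    refine Finset.sum_congr rfl fun c _ => ?_
    rw [Fintype.sum_prod_type]
  have hsub : ∀ f : ℕ → ℝ, (∀ j, 0 ≤ f j) → ∑ i ∈ Finset.range n, f (2 * i) ≤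
      ∑ j ∈ Finset.range (2 * n), f j ∧ ∑ i ∈ Finset.range n, f (2 * i + 1) ≤
      ∑ j ∈ Finset.range (2 * n), f j := by
    intro f hf
    rw [sum_range_two_mul, Finset.sum_add_distrib]
    exact ⟨le_add_of_nonneg_right (Finset.sum_nonneg fun _ _ => hf _),
      le_add_of_nonneg_left (Finset.sum_nonneg fun _ _ => hf _)⟩
  have h2 : ∑ i ∈ Finset.range n, ∑ v, ∑ v', P (2 * i + 1) v v' ^ 2 ≤
      sliceGramNorm X (2 * n * w) ^ 2 := by
    refine ((hsub (fun j => ∑ v, ∑ v', P j v v' ^ 2) fun j => by positivity).2).trans ?_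
    rw [sliceGramNorm, Real.sq_sqrt (by positivity)]
    refine (sum_gram_sq_le (Finset.range (2 * n)) (fun j => J j ×ˢ (Finset.univ : Finset A))
      (fun _ (ρ : ℕ × A) v => X v ρ.2 ρ.1)).trans (le_of_eq ?_)
    refine Finset.sum_congr rfl fun v _ => Finset.sum_congr rfl fun v' _ => ?_
    rw [sum_range_mul_eq_sum_blocks _ w (2 * n)]
    congr 1
    refine Finset.sum_congr rfl fun j _ => ?_
    rw [Finset.sum_product]
  have h3 : ∑ i ∈ Finset.range n, ∑ v, ∑ v', Q (2 * i) v v' ^ 2 ≤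
      blockGramNorm X w (2 * n) ^ 2 := by
    refine ((hsub (fun j => ∑ v, ∑ v', Q j v v' ^ 2) fun j => by positivity).1).trans ?_
    rw [blockGramNorm, Real.sq_sqrt (by positivity)]
    refine le_trans (le_of_eq ?_) (sum_gram_sq_le (Finset.range (2 * n))
      (fun _ => (Finset.univ : Finset V)) (fun j v a => blockPart X w j v a))
    refine Finset.sum_congr rfl fun j _ => ?_
    rw [← gramNorm_sq, ← gramNorm_swap, gramNorm_sq]
  rw [h1]
  have hcs := Finset.sum_mul_sq_le_sq_mul_sq (Finset.range n ×ˢ (Finset.univ : Finset (V × V)))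
    (fun q => P (2 * q.1 + 1) q.2.1 q.2.2) (fun q => Q (2 * q.1) q.2.1 q.2.2)
  simp only [Finset.sum_product, Fintype.sum_prod_type] at hcs
  have h0 : 0 ≤ sliceGramNorm X (2 * n * w) := Real.sqrt_nonneg _
  have h0' : 0 ≤ blockGramNorm X w (2 * n) := Real.sqrt_nonneg _
  refine le_of_abs_le (abs_le_of_sq_le_sq (hcs.trans ?_) (by positivity))
  rw [mul_pow]
  gcongr

end Blocks

/-- With `u_e` the norm for blocks of length `2^e` and `h` the slice norm, the cross term of a merge
is a martingale in the slice index, and `u_{e+1} ≤ u_e + 2 √(360 m h u_e)`. Thus `√u` increases by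
at most `√(360 m h)` in each of the `K` merges, and only `K²` is lost. -/
theorem momentNorm_blockGramNorm_le {Ω V A : Type*} [Fintype Ω] [Fintype V] [Fintype A] {m : ℕ}
    (hm : 2 ≤ m) (K : ℕ) (X : Ω → V → A → ℕ → ℝ) (τ : ℕ → Ω ≃ Ω)
    (hfix : ∀ c, ∀ c' < c, ∀ v a ω, X (τ c ω) v a c' = X ω v a c')
    (hodd : ∀ c v a ω, X (τ c ω) v a c = -X ω v a c) :
    momentNorm m (fun ω => blockGramNorm (X ω) (2 ^ K) 1) ≤
      2 * momentNorm m (fun ω => blockGramNorm (X ω) 1 (2 ^ K)) +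
        720 * m * K ^ 2 * momentNorm m (fun ω => sliceGramNorm (X ω) (2 ^ K)) := by
  have hpred : ∀ g : ℕ, g % 2 = 1 → g - 1 + 1 = g := fun g hg => by omega
  set h := momentNorm m (fun ω => sliceGramNorm (X ω) (2 ^ K)) with hh
  have hh0 : 0 ≤ h := momentNorm_nonneg _ _
  set u : ℕ → ℝ := fun e => momentNorm m (fun ω => blockGramNorm (X ω) (2 ^ e) (2 ^ (K - e))) with hu
  have hu0 : ∀ e, 0 ≤ u e := fun e => momentNorm_nonneg _ _
  have hstep : ∀ e < K, u (e + 1) ≤ u e + 2 * √(360 * m * (h * u e)) := by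
    intro e he
    have hN : 2 * 2 ^ (K - (e + 1)) * 2 ^ e = 2 ^ K := by
      rw [← pow_succ', ← pow_add]; congr 1; omega
    have hK : 2 * 2 ^ (K - (e + 1)) = 2 ^ (K - e) := by
      rw [← pow_succ']; congr 1; omega
    set E : Ω → ℝ := fun ω => √(∑ p, (∑ c ∈ Finset.range (2 ^ K),
      siblingTerm (X ω) (2 ^ e) c p) ^ 2) with hE
    have h1 : u (e + 1) ≤ u e + (momentNorm m E + momentNorm m E) := by
      refine le_trans (momentNorm_mono (by omega) (h := fun ω =>
        blockGramNorm (X ω) (2 ^ e) (2 ^ (K - e)) + (E ω + E ω)) fun ω => ?_)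
        ((momentNorm_add_le (by omega) _ _).trans (add_le_add le_rfl
          (momentNorm_add_le (by omega) _ _)))
      refine abs_le_abs_of_nonneg (Real.sqrt_nonneg _) ?_
      have := blockGramNorm_two_mul_le (X ω) (2 ^ e) (2 ^ (K - (e + 1)))
      rw [hN, hK, ← pow_succ'] at this
      rw [hE]
      simp only []
      linarith
    have h2 : momentNorm m E ^ 2 ≤ 360 * m * (h * u e) := by
      refine momentNorm_sq_le_of_square_function hm (2 ^ K)
        (fun c p ω => siblingTerm (X ω) (2 ^ e) c p) τ ?_ ?_ E _ _ (fun ω => ?_) (fun ω => ?_)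
      · intro c _ c' hc' p ω
        unfold siblingTerm
        split_ifs with hodd'
        · refine Finset.sum_congr rfl fun v _ => ?_
          rw [hfix c c' hc']
          congr 1
          refine Finset.sum_congr rfl fun b hb => ?_
          rw [Finset.mem_Ico] at hb
          refine hfix c b ?_ v p.2 ω
          have h3 : c' / 2 ^ e - 1 + 1 = c' / 2 ^ e := hpred _ hodd'
          rw [h3] at hb
          have := Nat.div_mul_le_self c' (2 ^ e)
          omega
        · rfl
      · intro c _ p ω
        unfold siblingTerm
        split_ifs with hodd'
        · rw [← Finset.sum_neg_distrib]
          refine Finset.sum_congr rfl fun v _ => ?_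
          rw [hodd c, ← neg_mul]
          congr 1
          refine Finset.sum_congr rfl fun b hb => ?_
          rw [Finset.mem_Ico] at hb
          refine hfix c b ?_ v p.2 ω
          have h3 : c / 2 ^ e - 1 + 1 = c / 2 ^ e := hpred _ hodd'
          rw [h3] at hb
          have := Nat.div_mul_le_self c (2 ^ e)
          omega
        · simp
      · rw [hE]
        simp only []
        rw [Real.sq_sqrt (by positivity)]
      · have := sum_siblingTerm_sq_le (X ω) (2 ^ e) (2 ^ (K - (e + 1)))
        rwa [hN, hK] at this
    have h3 := Real.le_sqrt_of_sq_le h2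
    linarith
  have hmain : ∀ e ≤ K, √(u e) ≤ √(u 0) + e * √(360 * m * h) := by
    intro e
    induction e with
    | zero => intro _; simp
    | succ e ih =>
      intro he
      have ih := ih (by omega)
      have h1 : √(u (e + 1)) ≤ √(u e) + √(360 * m * h) := by
        rw [Real.sqrt_le_left (by positivity)]
        refine (hstep e (by omega)).trans ?_
        rw [← mul_assoc, Real.sqrt_mul (by positivity), add_sq, Real.sq_sqrt (hu0 e),
          Real.sq_sqrt (by positivity)]
        have : 0 ≤ 360 * m * h := by positivity
        nlinarith
      push_cast
      linarith
  have h1 := hmain K le_rfl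
  have h2 : u K ≤ (√(u 0) + K * √(360 * m * h)) ^ 2 := by
    rw [← Real.sq_sqrt (hu0 K)]
    gcongr
  have e1 : u K = momentNorm m (fun ω => blockGramNorm (X ω) (2 ^ K) 1) := by simp [hu]
  have e2 : u 0 = momentNorm m (fun ω => blockGramNorm (X ω) 1 (2 ^ K)) := by simp [hu]
  rw [← e1, ← e2]
  -- The inequality `(x + y)² ≤ 2 (x² + y²)` produces the factors `2` and `720`.
  refine h2.trans ((add_sq_le).trans (le_of_eq ?_))
  rw [Real.sq_sqrt (hu0 0), mul_pow, Real.sq_sqrt (by positivity)]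
  ring

/-! ### Flip systems and the recursion on coordinates -/

/-- The sum of the functions `f r` over the indices `r` with prescribed row and column. -/
noncomputable def entry {d : ℕ} {V A : Type} [DecidableEq V] [DecidableEq A]
    (S : Finset (Fin d → ℕ)) (f : (Fin d → ℕ) → ℝ) (ρ : (Fin d → ℕ) → V) (χ : (Fin d → ℕ) → A)
    (v : V) (a : A) : ℝ :=
  ∑ r ∈ S with ρ r = v ∧ χ r = a, f r

/-- The joint behaviour of the functions `f r`, `r ∈ S`, under the flips `τ k c` of the `c`-th digit
of the `k`-th coordinate. -/
structure IsFlipSystem {d : ℕ} {Ω : Type*} (S : Finset (Fin d → ℕ)) (f : Ω → (Fin d → ℕ) → ℝ)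
    (τ : Fin d → ℕ → Ω ≃ Ω) : Prop where
  fix : ∀ r ∈ S, ∀ k c, r k < c → ∀ ω, f (τ k c ω) r = f ω r
  odd : ∀ r ∈ S, ∀ k ω, f (τ k (r k) ω) r = -f ω r
  sq_eq_one : ∀ r ∈ S, ∀ ω, f ω r ^ 2 = 1

/-- The Hilbert-Schmidt norm of the Gram matrix of the entries, as a function on `Ω`. -/
noncomputable def correlation {d : ℕ} {Ω : Type*} {V A : Type} [Fintype V] [Fintype A]
    [DecidableEq V] [DecidableEq A] (S : Finset (Fin d → ℕ)) (f : Ω → (Fin d → ℕ) → ℝ)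
    (ρ : (Fin d → ℕ) → V) (χ : (Fin d → ℕ) → A) (ω : Ω) : ℝ :=
  gramNorm (entry S (f ω) ρ χ)

/-- The `k`-th coordinate as an element of a finite type. -/
def coord {d : ℕ} (K : ℕ) (k : Fin d) (r : Fin d → ℕ) : Fin (2 ^ K) := Fin.ofNat (2 ^ K) (r k)

theorem coord_eq_iff {d K : ℕ} {k : Fin d} {r : Fin d → ℕ} (hr : r k < 2 ^ K) (c : Fin (2 ^ K)) :
    coord K k r = c ↔ r k = c := by
  rw [Fin.ext_iff, coord, Fin.val_ofNat, Nat.mod_eq_of_lt hr]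

section Recursion

variable {d : ℕ} {Ω : Type*} {V A : Type} [Fintype Ω] [Fintype V] [Fintype A]
    [DecidableEq V] [DecidableEq A] {S : Finset (Fin d → ℕ)} {f : Ω → (Fin d → ℕ) → ℝ}
    {τ : Fin d → ℕ → Ω ≃ Ω}

/-- Slicing along coordinate `k`: one block of length `2^K` forgets the coordinate, blocks of length
`1` put it into the row index, and the slice norm puts it into the column index. -/
theorem momentNorm_correlation_le (hf : IsFlipSystem S f τ) {m : ℕ} (hm : 2 ≤ m) {K : ℕ}
    {k : Fin d} (hK : ∀ r ∈ S, r k < 2 ^ K) (ρ : (Fin d → ℕ) → V) (χ : (Fin d → ℕ) → A) :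
    momentNorm m (correlation S f ρ χ) ≤
      2 * momentNorm m (correlation S f (fun r => (ρ r, coord K k r)) χ) +
      720 * m * K ^ 2 * momentNorm m (correlation S f ρ (fun r => (χ r, coord K k r))) := by
  set X : Ω → V → A → ℕ → ℝ := fun ω v a c =>
    ∑ r ∈ S with ρ r = v ∧ χ r = a ∧ r k = c, f ω r with hX
  have key := momentNorm_blockGramNorm_le hm K X (τ k) (by
      intro c c' hc v a ω
      refine Finset.sum_congr rfl fun r hr => ?_
      rw [Finset.mem_filter] at hr
      exact hf.fix r hr.1 k c (by omega) ω) (by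
      intro c v a ω
      simp only [hX]
      rw [← Finset.sum_neg_distrib]
      refine Finset.sum_congr rfl fun r hr => ?_
      rw [Finset.mem_filter] at hr
      rw [← hr.2.2.2]
      exact hf.odd r hr.1 k ω)
  have e1 : (fun ω => blockGramNorm (X ω) (2 ^ K) 1) = correlation S f ρ χ := by
    funext ω
    have : ∀ v a, blockPart (X ω) (2 ^ K) 0 v a = entry S (f ω) ρ χ v a := by
      intro v a
      simp only [blockPart, zero_mul, zero_add, one_mul, hX, entry]
      rw [← Finset.range_eq_Ico]
      symm
      refine (Finset.sum_fiberwise_of_maps_to (g := fun r : Fin d → ℕ => r k)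
        (t := Finset.range (2 ^ K)) ?_ _).symm.trans ?_
      rotate_left
      · refine Finset.sum_congr rfl fun c _ => ?_
        rw [Finset.filter_filter]
        refine Finset.sum_congr (Finset.filter_congr fun r _ => by tauto) fun _ _ => rfl
      · intro r hr
        rw [Finset.mem_filter] at hr
        exact Finset.mem_range.2 (hK r hr.1)
    simp [blockGramNorm, this, correlation, gramNorm]
  have e2 : (fun ω => blockGramNorm (X ω) 1 (2 ^ K)) =
      correlation S f (fun r => (ρ r, coord K k r)) χ := by
    funext ω
    have : ∀ v (c : Fin (2 ^ K)) a, blockPart (X ω) 1 c v a =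
        entry S (f ω) (fun r => (ρ r, coord K k r)) χ (v, c) a := by
      intro v c a
      simp only [blockPart, mul_one, hX, entry, Nat.Ico_succ_singleton, Finset.sum_singleton]
      refine Finset.sum_congr (Finset.filter_congr fun r hr => ?_) fun _ _ => rfl
      rw [Prod.mk.injEq, coord_eq_iff (hK r hr)]
      tauto
    simp only [blockGramNorm, correlation, gramNorm, Fintype.sum_prod_type, ← this]
    congr 1
    refine Finset.sum_congr rfl fun a _ => Finset.sum_congr rfl fun a' _ => ?_
    rw [Finset.sum_comm]
    congr 1
    refine Finset.sum_congr rfl fun v _ => ?_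
    rw [Fin.sum_univ_eq_sum_range (fun c => blockPart (X ω) 1 c v a * blockPart (X ω) 1 c v a')]
  have e3 : (fun ω => sliceGramNorm (X ω) (2 ^ K)) =
      correlation S f ρ (fun r => (χ r, coord K k r)) := by
    funext ω
    have : ∀ v (c : Fin (2 ^ K)) a, X ω v a c =
        entry S (f ω) ρ (fun r => (χ r, coord K k r)) v (a, c) := by
      intro v c a
      simp only [hX, entry]
      refine Finset.sum_congr (Finset.filter_congr fun r hr => ?_) fun _ _ => rfl
      rw [Prod.mk.injEq, coord_eq_iff (hK r hr)]
    rw [correlation, ← gramNorm_swap]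
    simp only [sliceGramNorm, gramNorm, Fintype.sum_prod_type, ← this]
    congr 1
    refine Finset.sum_congr rfl fun v _ => Finset.sum_congr rfl fun v' _ => ?_
    rw [Finset.sum_comm]
    congr 1
    refine Finset.sum_congr rfl fun a _ => ?_
    rw [Fin.sum_univ_eq_sum_range (fun c => X ω v a c * X ω v' a c)]
  rw [e1, e2, e3] at key
  exact key

end Recursion

/-! ### Counting pairs of hyperbolic vectors with a common row -/

theorem card_le_prod_of_determined {d : ℕ} {ι : Type*} (s : Finset ι) (φ : ι → Fin d → ℕ)
    (W : Finset (Fin d)) (T : Fin d → Finset ℕ) (hT : ∀ i ∈ s, ∀ k ∈ W, φ i k ∈ T k)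
    (hinj : ∀ i ∈ s, ∀ j ∈ s, (∀ k ∈ W, φ i k = φ j k) → i = j) :
    s.card ≤ ∏ k ∈ W, (T k).card := by
  classical
  have h := Finset.card_le_card_of_injOn (s := s) (t := Fintype.piFinset fun k : W => T k)
    (fun i k => φ i k) (fun i hi => by
      refine Finset.mem_coe.2 (Fintype.mem_piFinset.2 fun k => ?_)
      exact hT i hi k k.2) (fun i hi j hj hij => hinj i hi j hj fun k hk => congrFun hij ⟨k, hk⟩)
  rw [Fintype.card_piFinset] at h
  rwa [← Finset.prod_coe_sort W fun k => (T k).card]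

/-- The pairs of indices with a common row. -/
def rowPairs {d : ℕ} {V : Type} [DecidableEq V] (S : Finset (Fin d → ℕ)) (ρ : (Fin d → ℕ) → V) :
    Finset ((Fin d → ℕ) × (Fin d → ℕ)) :=
  {p ∈ S ×ˢ S | ρ p.1 = ρ p.2}

theorem mem_rowPairs {d : ℕ} {V : Type} [DecidableEq V] {ρ : (Fin d → ℕ) → V}
    {S : Finset (Fin d → ℕ)} {p : (Fin d → ℕ) × (Fin d → ℕ)} :
    p ∈ rowPairs S ρ ↔ (p.1 ∈ S ∧ p.2 ∈ S) ∧ ρ p.1 = ρ p.2 := by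
  simp [rowPairs]

theorem abs_sum_mul_le_card {d : ℕ} {S : Finset (Fin d → ℕ)} {f : (Fin d → ℕ) → ℝ} (hf : ∀ r ∈ S, f r ^ 2 = 1)
    {F : Finset ((Fin d → ℕ) × (Fin d → ℕ))} (hF : F ⊆ S ×ˢ S) :
    |∑ p ∈ F, f p.1 * f p.2| ≤ F.card := by
  have h1 : ∀ r ∈ S, |f r| ≤ 1 := fun r hr => by
    rw [← sq_le_one_iff_abs_le_one, hf r hr]
  refine (Finset.abs_sum_le_sum_abs _ _).trans ?_
  rw [Finset.cast_card]
  refine Finset.sum_le_sum fun p hp => ?_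
  have hp' := Finset.mem_product.1 (hF hp)
  rw [abs_mul]
  exact mul_le_one₀ (h1 _ hp'.1) (abs_nonneg _) (h1 _ hp'.2)

theorem sum_card_filter_eq {d : ℕ} {A : Type} [Fintype A] [DecidableEq A] {χ : (Fin d → ℕ) → A}
    (F : Finset ((Fin d → ℕ) × (Fin d → ℕ))) :
    ∑ a, ∑ a', (F.filter fun p => χ p.1 = a ∧ χ p.2 = a').card = F.card := by
  rw [Finset.card_eq_sum_card_fiberwise (f := fun p => (χ p.1, χ p.2)) (t := Finset.univ)
    (fun _ _ => Finset.mem_coe.2 (Finset.mem_univ _)), Fintype.sum_prod_type]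
  simp only [Prod.mk.injEq]

section Leaf

variable {d : ℕ} {V A : Type} [Fintype V] [DecidableEq V] [DecidableEq A]
  {S : Finset (Fin d → ℕ)} {ρ : (Fin d → ℕ) → V} {χ : (Fin d → ℕ) → A}

/-- Turns Gram entries into signed sums over pairs, so that they can be counted or split by the last
coordinate. -/
theorem sum_entry_mul_entry (f : (Fin d → ℕ) → ℝ) (a a' : A) :
    ∑ v, entry S f ρ χ v a * entry S f ρ χ v a' =
      ∑ p ∈ rowPairs S ρ with χ p.1 = a ∧ χ p.2 = a', f p.1 * f p.2 := by
  simp only [entry, rowPairs, Finset.sum_filter, Finset.sum_mul_sum, Finset.sum_product]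
  rw [Finset.sum_comm]
  refine Finset.sum_congr rfl fun r _ => ?_
  rw [Finset.sum_comm]
  refine Finset.sum_congr rfl fun s _ => ?_
  rw [Finset.sum_eq_single (ρ r)]
  · by_cases h1 : χ r = a <;> by_cases h2 : χ s = a' <;> by_cases h3 : ρ r = ρ s <;>
      simp [h1, h2, h3, eq_comm]
  · intro v _ hv
    rw [if_neg (fun h => hv h.1.symm), zero_mul]
  · simp

variable [Fintype A]

/-- The `ℓ²` norm of the matrix is at most its `ℓ¹` norm, and each pair contributes to exactly one
entry. -/
theorem gramNorm_entry_le_card {f : (Fin d → ℕ) → ℝ} (hf : ∀ r ∈ S, f r ^ 2 = 1) :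
    gramNorm (entry S f ρ χ) ≤ (rowPairs S ρ).card := by
  refine abs_le_of_sq_le_sq' ?_ (by positivity) |>.2
  rw [gramNorm_sq]
  simp_rw [sum_entry_mul_entry]
  rw [← Fintype.sum_prod_type' (f := fun a a' =>
    (∑ p ∈ rowPairs S ρ with χ p.1 = a ∧ χ p.2 = a', f p.1 * f p.2) ^ 2)]
  have hsub : ∀ q : A × A, (rowPairs S ρ).filter (fun p => χ p.1 = q.1 ∧ χ p.2 = q.2) ⊆ S ×ˢ S :=
    fun q => (Finset.filter_subset _ _).trans (Finset.filter_subset _ _)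
  calc ∑ q : A × A, (∑ p ∈ rowPairs S ρ with χ p.1 = q.1 ∧ χ p.2 = q.2, f p.1 * f p.2) ^ 2
      ≤ ∑ q : A × A,
        (((rowPairs S ρ).filter fun p => χ p.1 = q.1 ∧ χ p.2 = q.2).card : ℝ) ^ 2 := by
        refine Finset.sum_le_sum fun q _ => ?_
        rw [← sq_abs]
        gcongr
        exact abs_sum_mul_le_card hf (hsub q)
    _ ≤ (∑ q : A × A, (((rowPairs S ρ).filter fun p => χ p.1 = q.1 ∧ χ p.2 = q.2).card : ℝ)) ^ 2 :=
        Finset.sum_sq_le_sq_sum_of_nonneg fun _ _ => by positivity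
    _ = _ := by
        congr 1
        rw [Fintype.sum_prod_type]
        exact_mod_cast sum_card_filter_eq _

end Leaf

/-- The hyperbolic vectors whose first coordinate lies in `J`. -/
def hyperbolicSlab (d n : ℕ) [NeZero d] (J : Finset ℕ) : Finset (Fin d → ℕ) :=
  (hyperbolic d n).filter fun r => r 0 ∈ J

section Counting

variable {d n : ℕ} [NeZero d] {J : Finset ℕ}

theorem mem_hyperbolicSlab {r : Fin d → ℕ} :
    r ∈ hyperbolicSlab d n J ↔ ∑ k, r k = n ∧ r 0 ∈ J := by
  simp [hyperbolicSlab, hyperbolic]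

theorem lt_of_mem_hyperbolicSlab {r : Fin d → ℕ} (hr : r ∈ hyperbolicSlab d n J) (k : Fin d) :
    r k < n + 1 := by
  rw [mem_hyperbolicSlab] at hr
  have := Finset.single_le_sum (f := r) (fun _ _ => Nat.zero_le _) (Finset.mem_univ k)
  omega

theorem eq_of_agree_off {r s : Fin d → ℕ} (hr : r ∈ hyperbolicSlab d n J)
    (hs : s ∈ hyperbolicSlab d n J) (k₀ : Fin d) (h : ∀ k, k ≠ k₀ → r k = s k) : r = s := by
  rw [mem_hyperbolicSlab] at hr hs
  have h1 := Finset.add_sum_erase Finset.univ r (Finset.mem_univ k₀)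
  have h2 := Finset.add_sum_erase Finset.univ s (Finset.mem_univ k₀)
  have h3 : ∑ k ∈ Finset.univ.erase k₀, r k = ∑ k ∈ Finset.univ.erase k₀, s k :=
    Finset.sum_congr rfl fun k hk => h k (Finset.ne_of_mem_erase hk)
  funext k
  by_cases hk : k = k₀
  · subst hk; omega
  · exact h k hk

theorem prod_card_slab (W : Finset (Fin d)) (h0 : (0 : Fin d) ∈ W) :
    ∏ k ∈ W, (if k = 0 then J else Finset.range (n + 1)).card = J.card * (n + 1) ^ (W.card - 1) := by
  rw [← Finset.mul_prod_erase _ _ h0, if_pos rfl, Finset.prod_congr rfl (g := fun _ => n + 1)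
    (fun k hk => by rw [if_neg (Finset.ne_of_mem_erase hk), Finset.card_range]),
    Finset.prod_const, Finset.card_erase_of_mem h0]

theorem mem_slab_range {r : Fin d → ℕ} (hr : r ∈ hyperbolicSlab d n J) (k : Fin d) :
    r k ∈ (if k = 0 then J else Finset.range (n + 1)) := by
  split_ifs with h
  · subst h; exact (mem_hyperbolicSlab.1 hr).2
  · exact Finset.mem_range.2 (lt_of_mem_hyperbolicSlab hr k)

theorem card_hyperbolicSlab_le {l : Fin d} (hl : l ≠ 0) :
    (hyperbolicSlab d n J).card ≤ J.card * (n + 1) ^ (d - 2) := by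
  refine (card_le_prod_of_determined _ id (Finset.univ.erase l) _
    (fun r hr k _ => mem_slab_range hr k) fun r hr s hs h => ?_).trans (le_of_eq ?_)
  · exact eq_of_agree_off hr hs l fun k hk => h k (Finset.mem_erase.2 ⟨hk, Finset.mem_univ k⟩)
  · rw [prod_card_slab _ (Finset.mem_erase.2 ⟨hl.symm, Finset.mem_univ _⟩),
      Finset.card_erase_of_mem (Finset.mem_univ _), Finset.card_univ, Fintype.card_fin, Nat.sub_sub]

variable {V A : Type} [DecidableEq V] [DecidableEq A]
  {ρ : (Fin d → ℕ) → V} {χ : (Fin d → ℕ) → A} {P Q : Finset (Fin d)} {l : Fin d}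

/-- On `S`, the map `ρ` identifies exactly the vectors that agree on the coordinates in `P`. -/
def HasKernel {V : Type} (S : Finset (Fin d → ℕ)) (ρ : (Fin d → ℕ) → V) (P : Finset (Fin d)) :
    Prop :=
  ∀ r ∈ S, ∀ s ∈ S, ρ r = ρ s ↔ ∀ k ∈ P, r k = s k

theorem card_rowPairs_filter_le_mul {d : ℕ} {V : Type} [DecidableEq V] {ρ : (Fin d → ℕ) → V}
    {S : Finset (Fin d → ℕ)} (R : (Fin d → ℕ) × (Fin d → ℕ) → Prop) [DecidablePred R] (b : ℕ) (h : ∀ r ∈ S,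
      (((rowPairs S ρ).filter R).filter fun p => p.1 = r).card ≤ b) :
    ((rowPairs S ρ).filter R).card ≤ b * S.card :=
  Finset.card_le_mul_card_image_of_maps_to (f := Prod.fst)
    (fun _ hp => (mem_rowPairs.1 (Finset.mem_filter.1 hp).1).1.1) b h

/-- Given the first vector, the second inherits its coordinates in `P`, and the fixed sum recovers
coordinate `l`; only `Q` is free. -/
theorem card_rowPairs_le (hρ : HasKernel (hyperbolicSlab d n J) ρ P)
    (hPQ : ∀ k, k ∈ P ∨ k ∈ Q ∨ k = l) :
    (rowPairs (hyperbolicSlab d n J) ρ).card ≤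
      (n + 1) ^ Q.card * (hyperbolicSlab d n J).card := by
  have := card_rowPairs_filter_le_mul (S := hyperbolicSlab d n J) (ρ := ρ) (fun _ => True)
    ((n + 1) ^ Q.card) fun r hr => ?_
  · simpa using this
  refine (card_le_prod_of_determined _ Prod.snd Q (fun _ => Finset.range (n + 1))
    (fun p hp k _ => ?_) fun p hp p' hp' h => ?_).trans (by simp)
  · simp only [Finset.mem_filter, mem_rowPairs] at hp
    exact Finset.mem_range.2 (lt_of_mem_hyperbolicSlab hp.1.1.1.2 k)
  · simp only [Finset.mem_filter, mem_rowPairs] at hp hp'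
    have h1 : p.1 = p'.1 := hp.2.trans hp'.2.symm
    have h2 : ρ p.2 = ρ p'.2 := by rw [← hp.1.1.2, ← hp'.1.1.2, h1]
    refine Prod.ext h1 (eq_of_agree_off hp.1.1.1.2 hp'.1.1.1.2 l fun k hk => ?_)
    rcases hPQ k with hkP | hkQ | hkl
    · exact (hρ _ hp.1.1.1.2 _ hp'.1.1.1.2).1 h2 k hkP
    · exact h k hkQ
    · exact absurd hkl hk

/-- When the vectors also agree at `l`, the fixed sum determines one coordinate of `Q`, saving a
factor `n + 1`. -/
theorem card_rowPairs_eq_le (hρ : HasKernel (hyperbolicSlab d n J) ρ P)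
    (hPQ : ∀ k, k ∈ P ∨ k ∈ Q ∨ k = l) (hQ : Q.Nonempty) :
    ((rowPairs (hyperbolicSlab d n J) ρ).filter fun p => p.1 l = p.2 l).card ≤
      (n + 1) ^ (Q.card - 1) * (hyperbolicSlab d n J).card := by
  obtain ⟨q, hq⟩ := hQ
  refine card_rowPairs_filter_le_mul _ _ fun r hr => ?_
  refine (card_le_prod_of_determined _ Prod.snd (Q.erase q) (fun _ => Finset.range (n + 1))
    (fun p hp k _ => ?_) fun p hp p' hp' h => ?_).trans (by simp [Finset.card_erase_of_mem hq])
  · simp only [Finset.mem_filter, mem_rowPairs] at hp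
    exact Finset.mem_range.2 (lt_of_mem_hyperbolicSlab hp.1.1.1.2 k)
  · simp only [Finset.mem_filter, mem_rowPairs] at hp hp'
    have h1 : p.1 = p'.1 := hp.2.trans hp'.2.symm
    have h2 : ρ p.2 = ρ p'.2 := by rw [← hp.1.1.2, ← hp'.1.1.2, h1]
    refine Prod.ext h1 (eq_of_agree_off hp.1.1.1.2 hp'.1.1.1.2 q fun k hk => ?_)
    rcases hPQ k with hkP | hkQ | hkl
    · exact (hρ _ hp.1.1.1.2 _ hp'.1.1.1.2).1 h2 k hkP
    · exact h k (Finset.mem_erase.2 ⟨hk, hkQ⟩)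
    · rw [hkl, ← hp.1.2, ← hp'.1.2, h1]

/-- Prescribed columns fix the coordinates in `Q` of both vectors, so the common coordinates in `P`
determine the pair; coordinate `0` takes only `J.card` values. -/
theorem card_rowPairs_entry_le (hχ : HasKernel (hyperbolicSlab d n J) χ Q)
    (hρ : HasKernel (hyperbolicSlab d n J) ρ P) (hPQ : ∀ k, k ∈ P ∨ k ∈ Q ∨ k = l)
    (h0 : (0 : Fin d) ∈ P) (a a' : A) :
    ((rowPairs (hyperbolicSlab d n J) ρ).filter fun p => χ p.1 = a ∧ χ p.2 = a').card ≤
      J.card * (n + 1) ^ (P.card - 1) := by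
  rw [← prod_card_slab P h0]
  refine card_le_prod_of_determined _ Prod.fst P _ (fun p hp k _ => ?_) fun p hp p' hp' h => ?_
  · simp only [Finset.mem_filter, mem_rowPairs] at hp
    exact mem_slab_range hp.1.1.1 k
  · simp only [Finset.mem_filter, mem_rowPairs] at hp hp'
    have h1 : p.1 = p'.1 := by
      refine eq_of_agree_off hp.1.1.1 hp'.1.1.1 l fun k hk => ?_
      rcases hPQ k with hkP | hkQ | hkl
      · exact h k hkP
      · exact (hχ _ hp.1.1.1 _ hp'.1.1.1).1 (hp.2.1.trans hp'.2.1.symm) k hkQ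
      · exact absurd hkl hk
    have h2 : ρ p.2 = ρ p'.2 := by rw [← hp.1.2, ← hp'.1.2, h1]
    refine Prod.ext h1 (eq_of_agree_off hp.1.1.2 hp'.1.1.2 l fun k hk => ?_)
    rcases hPQ k with hkP | hkQ | hkl
    · exact (hρ _ hp.1.1.2 _ hp'.1.1.2).1 h2 k hkP
    · exact (hχ _ hp.1.1.2 _ hp'.1.1.2).1 (hp.2.2.trans hp'.2.2.symm) k hkQ
    · exact absurd hkl hk

/-- Fixing coordinate `l` as well lets the fixed sum recover coordinate `0`, so the factor `J.card`
disappears. This is the source of the gain for unequal pairs. -/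
theorem card_rowPairs_entry_slice_le (hχ : HasKernel (hyperbolicSlab d n J) χ Q)
    (hρ : HasKernel (hyperbolicSlab d n J) ρ P) (hPQ : ∀ k, k ∈ P ∨ k ∈ Q ∨ k = l)
    (h0 : (0 : Fin d) ∈ P) (a a' : A) (c : ℕ) :
    ((rowPairs (hyperbolicSlab d n J) ρ).filter fun p =>
      (χ p.1 = a ∧ χ p.2 = a') ∧ p.1 l = c).card ≤ (n + 1) ^ (P.card - 1) := by
  refine (card_le_prod_of_determined _ Prod.fst (P.erase 0) (fun _ => Finset.range (n + 1))
    (fun p hp k _ => ?_) fun p hp p' hp' h => ?_).trans (by simp [Finset.card_erase_of_mem h0])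
  · simp only [Finset.mem_filter, mem_rowPairs] at hp
    exact Finset.mem_range.2 (lt_of_mem_hyperbolicSlab hp.1.1.1 k)
  · simp only [Finset.mem_filter, mem_rowPairs] at hp hp'
    have h1 : p.1 = p'.1 := by
      refine eq_of_agree_off hp.1.1.1 hp'.1.1.1 0 fun k hk => ?_
      rcases hPQ k with hkP | hkQ | hkl
      · exact h k (Finset.mem_erase.2 ⟨hk, hkP⟩)
      · exact (hχ _ hp.1.1.1 _ hp'.1.1.1).1 (hp.2.1.1.trans hp'.2.1.1.symm) k hkQ
      · rw [hkl]; exact hp.2.2.trans hp'.2.2.symm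
    have h2 : ρ p.2 = ρ p'.2 := by rw [← hp.1.2, ← hp'.1.2, h1]
    refine Prod.ext h1 (eq_of_agree_off hp.1.1.2 hp'.1.1.2 l fun k hk => ?_)
    rcases hPQ k with hkP | hkQ | hkl
    · exact (hρ _ hp.1.1.2 _ hp'.1.1.2).1 h2 k hkP
    · exact (hχ _ hp.1.1.2 _ hp'.1.1.2).1 (hp.2.1.2.trans hp'.2.1.2.symm) k hkQ
    · exact absurd hkl hk

end Counting

/-! ### Leaf estimate when some coordinate indexes columns -/

/-- The number of vectors in a slab, up to a constant, times the square root of the gain. -/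
noncomputable def leafBound (d n : ℕ) (J : Finset ℕ) : ℝ := √J.card * (n + 1 : ℝ) ^ (d - 2)

theorem leafBound_nonneg {d n : ℕ} {J : Finset ℕ} : 0 ≤ leafBound d n J := by unfold leafBound; positivity

theorem leafBound_sq {d n : ℕ} {J : Finset ℕ} (hd : 3 ≤ d) : leafBound d n J ^ 2 = J.card * (n + 1 : ℝ) ^ (2 * d - 4) := by
  rw [leafBound, mul_pow, Real.sq_sqrt (by positivity), ← pow_mul]
  congr 2
  omega

section LeafEstimate

variable {d n : ℕ} [NeZero d] {J : Finset ℕ} {V A : Type} [Fintype A] [DecidableEq V]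
  [DecidableEq A] {ρ : (Fin d → ℕ) → V} {χ : (Fin d → ℕ) → A} {P Q : Finset (Fin d)} {l : Fin d}

/-- Pairs with `p.1 l = p.2 l` have no cancellation in coordinate `l`, but are few: the sum of
squared counts is at most the largest count times their total. -/
theorem sum_equal_pairs_sq_le {f : (Fin d → ℕ) → ℝ} (hd : 3 ≤ d)
    (hf : ∀ r ∈ hyperbolicSlab d n J, f r ^ 2 = 1)
    (hχ : HasKernel (hyperbolicSlab d n J) χ Q)
    (hρ : HasKernel (hyperbolicSlab d n J) ρ P) (hPQ : ∀ k, k ∈ P ∨ k ∈ Q ∨ k = l)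
    (hcard : P.card + Q.card = d - 1) (hl : l ≠ 0)
    (h0 : (0 : Fin d) ∈ P) (hQ : Q.Nonempty) (hJ : J.card ≤ n + 1) :
    ∑ q : A × A, (∑ p ∈ (rowPairs (hyperbolicSlab d n J) ρ).filter fun p =>
      (χ p.1 = q.1 ∧ χ p.2 = q.2) ∧ p.1 l = p.2 l, f p.1 * f p.2) ^ 2 ≤ leafBound d n J ^ 2 := by
  set S := hyperbolicSlab d n J with hS
  set F := (rowPairs S ρ).filter fun p => p.1 l = p.2 l with hF
  set N : A × A → ℕ := fun q => (F.filter fun p => χ p.1 = q.1 ∧ χ p.2 = q.2).card with hN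
  have hP1 : 1 ≤ P.card := Finset.card_pos.2 ⟨0, h0⟩
  have hQ1 : 1 ≤ Q.card := Finset.card_pos.2 hQ
  have hle : ∀ q, N q ≤ J.card * (n + 1) ^ (P.card - 1) := fun q =>
    (Finset.card_le_card fun p hp => by
      simp only [hF, Finset.mem_filter] at hp ⊢
      exact ⟨hp.1.1, hp.2⟩).trans (card_rowPairs_entry_le hχ hρ hPQ h0 q.1 q.2)
  have hsum : ∑ q, N q ≤ (n + 1) ^ (Q.card - 1) * (J.card * (n + 1) ^ (d - 2)) := by
    rw [Fintype.sum_prod_type, sum_card_filter_eq]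
    exact (card_rowPairs_eq_le hρ hPQ hQ).trans (Nat.mul_le_mul_left _ (card_hyperbolicSlab_le hl))
  have hnat : ∑ q, N q ^ 2 ≤ J.card * (n + 1) ^ (2 * d - 4) := by
    calc ∑ q, N q ^ 2 ≤ ∑ q, J.card * (n + 1) ^ (P.card - 1) * N q := by
          refine Finset.sum_le_sum fun q _ => ?_
          rw [sq]
          exact Nat.mul_le_mul_right _ (hle q)
      _ = J.card * (n + 1) ^ (P.card - 1) * ∑ q, N q := by rw [Finset.mul_sum]
      _ ≤ J.card * (n + 1) ^ (P.card - 1) *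
          ((n + 1) ^ (Q.card - 1) * (J.card * (n + 1) ^ (d - 2))) := Nat.mul_le_mul_left _ hsum
      _ = J.card * J.card * (n + 1) ^ ((P.card - 1) + (Q.card - 1) + (d - 2)) := by
          rw [pow_add, pow_add]; ring
      -- One factor `J.card` is traded for `n + 1`, since the coincidence at `l` has saved a power
      -- of `n + 1`.
      _ ≤ J.card * (n + 1) * (n + 1) ^ ((P.card - 1) + (Q.card - 1) + (d - 2)) := by gcongr
      _ = J.card * (n + 1) ^ (2 * d - 4) := by
          rw [mul_assoc, ← pow_succ']
          congr 2
          omega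
  rw [leafBound_sq hd]
  refine le_trans (Finset.sum_le_sum fun q _ => ?_) (by exact_mod_cast hnat :
    ∑ q, (N q : ℝ) ^ 2 ≤ J.card * (n + 1 : ℝ) ^ (2 * d - 4))
  rw [← sq_abs]
  gcongr
  refine (abs_sum_mul_le_card hf ((Finset.filter_subset _ _).trans (Finset.filter_subset _ _))).trans
    ?_
  rw [hN, hF]
  simp only [Finset.filter_filter]
  exact_mod_cast Finset.card_le_card fun p hp => by
    simp only [rowPairs, Finset.mem_filter] at hp ⊢
    tauto

/-- Bounds the square function of the pairs with distinct `l`-th coordinates, sliced by the larger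
one: largest count times total count, with `J.card` appearing only in the total. -/
theorem sum_slice_pairs_sq_le {f : (Fin d → ℕ) → ℝ} (hd : 3 ≤ d)
    (hf : ∀ r ∈ hyperbolicSlab d n J, f r ^ 2 = 1)
    (hχ : HasKernel (hyperbolicSlab d n J) χ Q)
    (hρ : HasKernel (hyperbolicSlab d n J) ρ P) (hPQ : ∀ k, k ∈ P ∨ k ∈ Q ∨ k = l)
    (hcard : P.card + Q.card = d - 1) (hl : l ≠ 0) (h0 : (0 : Fin d) ∈ P) :
    ∑ c ∈ Finset.range (n + 1), ∑ q : A × A,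
      (∑ p ∈ (rowPairs (hyperbolicSlab d n J) ρ).filter fun p =>
        (χ p.1 = q.1 ∧ χ p.2 = q.2) ∧ p.1 l = c ∧ p.2 l < c, f p.1 * f p.2) ^ 2 ≤
      leafBound d n J ^ 2 := by
  set S := hyperbolicSlab d n J with hS
  set N : ℕ → A × A → ℕ := fun c q =>
    ((rowPairs S ρ).filter fun p => (χ p.1 = q.1 ∧ χ p.2 = q.2) ∧ p.1 l = c).card with hN
  have hP1 : 1 ≤ P.card := Finset.card_pos.2 ⟨0, h0⟩
  have hle : ∀ c q, N c q ≤ (n + 1) ^ (P.card - 1) := fun c q =>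
    card_rowPairs_entry_slice_le hχ hρ hPQ h0 q.1 q.2 c
  have hsum : ∑ c ∈ Finset.range (n + 1), ∑ q, N c q ≤
      (n + 1) ^ Q.card * (J.card * (n + 1) ^ (d - 2)) := by
    refine le_trans (le_of_eq ?_) ((card_rowPairs_le (J := J) hρ hPQ).trans
      (Nat.mul_le_mul_left _ (card_hyperbolicSlab_le hl)))
    rw [Finset.sum_comm, ← sum_card_filter_eq (χ := χ), Fintype.sum_prod_type]
    refine Finset.sum_congr rfl fun a _ => Finset.sum_congr rfl fun a' _ => ?_
    rw [Finset.card_eq_sum_card_fiberwise (f := fun p => p.1 l) (t := Finset.range (n + 1))]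
    · refine Finset.sum_congr rfl fun c _ => ?_
      rw [hN, Finset.filter_filter]
    · intro p hp
      have hp := Finset.mem_filter.1 (Finset.mem_coe.1 hp)
      exact Finset.mem_coe.2 (Finset.mem_range.2
        (lt_of_mem_hyperbolicSlab (mem_rowPairs.1 hp.1).1.1 l))
  have hnat : ∑ c ∈ Finset.range (n + 1), ∑ q, N c q ^ 2 ≤ J.card * (n + 1) ^ (2 * d - 4) := by
    calc ∑ c ∈ Finset.range (n + 1), ∑ q, N c q ^ 2
        ≤ ∑ c ∈ Finset.range (n + 1), ∑ q, (n + 1) ^ (P.card - 1) * N c q := by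
          refine Finset.sum_le_sum fun c _ => Finset.sum_le_sum fun q _ => ?_
          rw [sq]
          exact Nat.mul_le_mul_right _ (hle c q)
      _ = (n + 1) ^ (P.card - 1) * ∑ c ∈ Finset.range (n + 1), ∑ q, N c q := by
          simp_rw [Finset.mul_sum]
      _ ≤ (n + 1) ^ (P.card - 1) *
          ((n + 1) ^ Q.card * (J.card * (n + 1) ^ (d - 2))) := Nat.mul_le_mul_left _ hsum
      _ = J.card * (n + 1) ^ ((P.card - 1) + Q.card + (d - 2)) := by
          rw [pow_add, pow_add]; ring
      _ = J.card * (n + 1) ^ (2 * d - 4) := by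
          congr 2
          omega
  rw [leafBound_sq hd]
  refine le_trans (Finset.sum_le_sum fun c _ => Finset.sum_le_sum fun q _ => ?_)
    (by exact_mod_cast hnat :
      ∑ c ∈ Finset.range (n + 1), ∑ q, (N c q : ℝ) ^ 2 ≤ J.card * (n + 1 : ℝ) ^ (2 * d - 4))
  rw [← sq_abs]
  gcongr
  refine (abs_sum_mul_le_card hf ((Finset.filter_subset _ _).trans (Finset.filter_subset _ _))).trans
    ?_
  exact_mod_cast Finset.card_le_card fun p hp => by
    simp only [rowPairs, Finset.mem_filter] at hp ⊢
    tauto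

variable [Fintype V]

/-- The Gram entries split by comparing the `l`-th coordinates of the two vectors. Equal pairs are
counted; the two unequal parts are transposes of each other, and each is a martingale in the larger
`l`-th coordinate, since flipping that digit changes the sign of exactly one factor. -/
theorem momentNorm_leaf_le {Ω : Type*} [Fintype Ω] [Nonempty Ω] {f : Ω → (Fin d → ℕ) → ℝ}
    {τ : Fin d → ℕ → Ω ≃ Ω} (hf : IsFlipSystem (hyperbolicSlab d n J) f τ) (hd : 3 ≤ d) {m : ℕ}
    (hm : 2 ≤ m) (hχ : HasKernel (hyperbolicSlab d n J) χ Q)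
    (hρ : HasKernel (hyperbolicSlab d n J) ρ P) (hPQ : ∀ k, k ∈ P ∨ k ∈ Q ∨ k = l)
    (hcard : P.card + Q.card = d - 1) (hl : l ≠ 0)
    (h0 : (0 : Fin d) ∈ P) (hQ : Q.Nonempty) (hJ : J.card ≤ n + 1) :
    momentNorm m (correlation (hyperbolicSlab d n J) f ρ χ) ≤ 40 * √m * leafBound d n J := by
  set S := hyperbolicSlab d n J with hS
  set b := leafBound d n J with hb
  have hb0 : 0 ≤ b := leafBound_nonneg
  set D : ℕ → A × A → Ω → ℝ := fun c q ω => ∑ p ∈ (rowPairs S ρ).filter fun p =>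
        (χ p.1 = q.1 ∧ χ p.2 = q.2) ∧ p.1 l = c ∧ p.2 l < c, f ω p.1 * f ω p.2 with hD
  set T1 : Ω → A × A → ℝ := fun ω q => ∑ p ∈ (rowPairs S ρ).filter fun p =>
      (χ p.1 = q.1 ∧ χ p.2 = q.2) ∧ p.1 l = p.2 l, f ω p.1 * f ω p.2 with hT1
  set T2 : Ω → A × A → ℝ := fun ω q => ∑ c ∈ Finset.range (n + 1), D c q ω with hT2
  have hT2' : ∀ ω q, T2 ω q = ∑ p ∈ (rowPairs S ρ).filter fun p =>
      (χ p.1 = q.1 ∧ χ p.2 = q.2) ∧ p.2 l < p.1 l, f ω p.1 * f ω p.2 := by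
    intro ω q
    symm
    refine (Finset.sum_fiberwise_of_maps_to (g := fun p : (Fin d → ℕ) × (Fin d → ℕ) => p.1 l)
        (t := Finset.range (n + 1)) ?_ _).symm.trans ?_
    · intro p hp
      exact Finset.mem_range.2
        (lt_of_mem_hyperbolicSlab (mem_rowPairs.1 (Finset.mem_filter.1 hp).1).1.1 l)
    · refine Finset.sum_congr rfl fun c _ => ?_
      rw [Finset.filter_filter]
      refine Finset.sum_congr (Finset.filter_congr fun p _ => ?_) fun _ _ => rfl
      constructor
      · rintro ⟨⟨h1, h2⟩, h3⟩
        exact ⟨h1, h3, h3 ▸ h2⟩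
      · rintro ⟨h1, h2, h3⟩
        exact ⟨⟨h1, h2 ▸ h3⟩, h2⟩
  have hT3' : ∀ ω (q : A × A), T2 ω (q.2, q.1) = ∑ p ∈ (rowPairs S ρ).filter fun p =>
      (χ p.1 = q.1 ∧ χ p.2 = q.2) ∧ p.1 l < p.2 l, f ω p.1 * f ω p.2 := by
    intro ω q
    rw [hT2']
    refine Finset.sum_equiv (Equiv.prodComm _ _) (fun p => ?_) (fun p _ => ?_)
    · simp only [Finset.mem_filter, mem_rowPairs, Equiv.prodComm_apply, Prod.fst_swap,
        Prod.snd_swap, eq_comm (a := ρ p.1)]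
      tauto
    · simp [mul_comm]
  have hsplit : ∀ ω (q : A × A), ∑ v, entry S (f ω) ρ χ v q.1 * entry S (f ω) ρ χ v q.2 =
      T1 ω q + (T2 ω q + T2 ω (q.2, q.1)) := by
    intro ω q
    rw [sum_entry_mul_entry, hT3', hT2', hT1]
    simp only [Finset.sum_filter]
    rw [← Finset.sum_add_distrib, ← Finset.sum_add_distrib]
    refine Finset.sum_congr rfl fun p _ => ?_
    rcases lt_trichotomy (p.1 l) (p.2 l) with h | h | h
    · simp [h, h.ne, h.not_gt]
    · simp [h]
    · simp [h, h.ne', h.not_gt]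
  set E : Ω → ℝ := fun ω => √(∑ q, T2 ω q ^ 2) with hE
  have hE0 : ∀ ω, 0 ≤ E ω := fun ω => Real.sqrt_nonneg _
  have hpt : ∀ ω, correlation S f ρ χ ω ≤ b + (E ω + E ω) := by
    intro ω
    have e1 : correlation S f ρ χ ω = √(∑ q, (T1 ω q + (T2 ω q + T2 ω (q.2, q.1))) ^ 2) := by
      rw [correlation, gramNorm, ← Fintype.sum_prod_type' (f := fun a a' =>
        (∑ v, entry S (f ω) ρ χ v a * entry S (f ω) ρ χ v a') ^ 2)]
      simp_rw [← hsplit]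
    rw [e1]
    refine (sqrt_sum_add_sq_le _ _).trans (add_le_add ?_ ((sqrt_sum_add_sq_le _ _).trans
      (add_le_add le_rfl (le_of_eq ?_))))
    · exact Real.sqrt_le_iff.2 ⟨hb0, sum_equal_pairs_sq_le hd (fun r hr => hf.sq_eq_one r hr ω)
        hχ hρ hPQ hcard hl h0 hQ hJ⟩
    · rw [hE]
      simp only []
      rw [← Equiv.sum_comp (Equiv.prodComm A A) (fun q => T2 ω q ^ 2)]
      rfl
  -- The square function has the deterministic bound `b²`, so the second factor of the product is
  -- taken to be `1`.
  have hEb : momentNorm m E ^ 2 ≤ 360 * m * (momentNorm m (fun _ : Ω => b ^ 2) *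
      momentNorm m (fun _ : Ω => (1 : ℝ))) := by
    refine momentNorm_sq_le_of_square_function hm (n + 1) D (τ l) ?_ ?_ E _ _ (fun ω => ?_)
      (fun ω => ?_)
    · intro c _ c' hc' q ω
      refine Finset.sum_congr rfl fun p hp => ?_
      rw [Finset.mem_filter, mem_rowPairs] at hp
      obtain ⟨⟨⟨h1, h2⟩, _⟩, _, h3, h4⟩ := hp
      rw [hf.fix _ h1 l c (by omega), hf.fix _ h2 l c (by omega)]
    · intro c _ q ω
      rw [hD]
      simp only []
      rw [← Finset.sum_neg_distrib]
      refine Finset.sum_congr rfl fun p hp => ?_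
      rw [Finset.mem_filter, mem_rowPairs] at hp
      obtain ⟨⟨⟨h1, h2⟩, _⟩, _, h3, h4⟩ := hp
      rw [hf.fix _ h2 l c h4, ← h3, hf.odd _ h1 l, neg_mul]
    · rw [hE]
      simp only []
      rw [Real.sq_sqrt (by positivity)]
    · rw [mul_one]
      exact sum_slice_pairs_sq_le hd (fun r hr => hf.sq_eq_one r hr ω) hχ hρ hPQ hcard hl h0
  have hg : momentNorm m (fun _ : Ω => b ^ 2) ≤ b ^ 2 :=
    momentNorm_le_of_abs_le (by omega) fun _ => (abs_of_nonneg (by positivity)).le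
  have h1 : momentNorm m (fun _ : Ω => (1 : ℝ)) ≤ 1 :=
    momentNorm_le_of_abs_le (by omega) fun _ => by simp
  have hEb' : momentNorm m E ≤ 19 * √m * b := by
    refine le_of_sq_le_sq ?_ (by positivity)
    calc momentNorm m E ^ 2 ≤ 360 * m * (b ^ 2 * 1) := hEb.trans (by
          have := momentNorm_nonneg m (fun _ : Ω => (1 : ℝ))
          gcongr)
      _ ≤ 361 * m * b ^ 2 := by rw [mul_one]; gcongr; norm_num
      _ = (19 * √m * b) ^ 2 := by rw [mul_pow, mul_pow, Real.sq_sqrt (by positivity)]; norm_num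
  have hm1 : 1 ≤ √(m : ℝ) := Real.one_le_sqrt.2 (by exact_mod_cast (by omega : 1 ≤ m))
  calc momentNorm m (correlation S f ρ χ)
      ≤ momentNorm m (fun ω => b + (E ω + E ω)) := momentNorm_mono (by omega) fun ω =>
        abs_le_abs_of_nonneg (gramNorm_nonneg _) (hpt ω)
    _ ≤ momentNorm m (fun _ : Ω => b) + (momentNorm m E + momentNorm m E) :=
        (momentNorm_add_le (by omega) _ _).trans (add_le_add le_rfl
          (momentNorm_add_le (by omega) _ _))
    _ ≤ b + (19 * √m * b + 19 * √m * b) := by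
        gcongr
        exact momentNorm_le_of_abs_le (by omega) fun _ => (abs_of_nonneg hb0).le
    -- The bound is `(1 + 38 √m) b`, and `1 ≤ √m`.
    _ ≤ _ := by nlinarith

end LeafEstimate

/-! ### Induction over the coordinates not yet assigned to rows or columns -/

theorem HasKernel.insert_coord {d : ℕ} {V : Type} {S : Finset (Fin d → ℕ)} {ρ : (Fin d → ℕ) → V}
    {P : Finset (Fin d)} (h : HasKernel S ρ P) {K : ℕ} {k : Fin d} (hK : ∀ r ∈ S, r k < 2 ^ K) :
    HasKernel S (fun r => (ρ r, coord K k r)) (insert k P) := by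
  intro r hr s hs
  have h1 : r k = s k ↔ coord K k r = coord K k s := by
    rw [coord_eq_iff (hK r hr), coord, Fin.val_ofNat, Nat.mod_eq_of_lt (hK s hs)]
  rw [Prod.mk.injEq, h r hr s hs, ← h1, Finset.forall_mem_insert, and_comm]

section Induction

variable {d n : ℕ} [NeZero d] {J : Finset ℕ} {l : Fin d} {Ω : Type*} [Fintype Ω] [Nonempty Ω]
  {f : Ω → (Fin d → ℕ) → ℝ} {τ : Fin d → ℕ → Ω ≃ Ω}

/-- Once a column coordinate is present, both branches end in leaves with the gain, so each step
simply multiplies the bound by `2 + 720 m K² ≤ 722 m K²`. -/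
theorem momentNorm_correlation_le_of_nonempty (hf : IsFlipSystem (hyperbolicSlab d n J) f τ)
    (hd : 3 ≤ d) {m K : ℕ} (hm : 2 ≤ m) (hK : n < 2 ^ K) (hK1 : 1 ≤ K) (hl : l ≠ 0)
    (hJ : J.card ≤ n + 1) (U : Finset (Fin d)) :
    ∀ (P Q : Finset (Fin d)) (V A : Type) [Fintype V] [Fintype A] [DecidableEq V] [DecidableEq A]
      (ρ : (Fin d → ℕ) → V) (χ : (Fin d → ℕ) → A),
      HasKernel (hyperbolicSlab d n J) ρ P → HasKernel (hyperbolicSlab d n J) χ Q →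
      (∀ k, k ∈ P ∨ k ∈ Q ∨ k ∈ U ∨ k = l) → (∀ k ∈ U, k ∉ P ∧ k ∉ Q) →
      P.card + Q.card + U.card = d - 1 → (0 : Fin d) ∈ P → Q.Nonempty →
      momentNorm m (correlation (hyperbolicSlab d n J) f ρ χ) ≤
        (722 * (m * K ^ 2)) ^ U.card * (40 * √m * leafBound d n J) := by
  have hKS : ∀ k, ∀ r ∈ hyperbolicSlab d n J, r k < 2 ^ K := fun k r hr => by
    have := lt_of_mem_hyperbolicSlab hr k
    omega
  have hy : (1 : ℝ) ≤ m * K ^ 2 := by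
    exact_mod_cast Nat.mul_pos (by omega : 0 < m) (by positivity)
  have hX : 0 ≤ 40 * √(m : ℝ) * leafBound d n J := mul_nonneg (by positivity) leafBound_nonneg
  induction U using Finset.induction_on with
  | empty =>
    intro P Q V A _ _ _ _ ρ χ hρ hχ hPQ _ hcard h0 hQ
    simp only [Finset.card_empty, pow_zero, one_mul, add_zero] at hcard ⊢
    exact momentNorm_leaf_le hf hd hm hχ hρ (by simpa using hPQ) hcard hl h0 hQ hJ
  | insert k U hkU ih =>
    intro P Q V A _ _ _ _ ρ χ hρ hχ hPQ hU hcard h0 hQ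
    obtain ⟨hkP, hkQ⟩ := hU k (Finset.mem_insert_self _ _)
    rw [Finset.card_insert_of_notMem hkU] at hcard ⊢
    have h1 := ih (insert k P) Q _ _ (fun r => (ρ r, coord K k r)) χ (hρ.insert_coord (hKS k)) hχ
      (fun j => by have := hPQ j; simp only [Finset.mem_insert] at this ⊢; tauto)
      (fun j hj => by
        have := hU j (Finset.mem_insert_of_mem hj)
        refine ⟨fun h => ?_, this.2⟩
        rcases Finset.mem_insert.1 h with h | h
        · exact hkU (h ▸ hj)
        · exact this.1 h)
      (by rw [Finset.card_insert_of_notMem hkP]; omega) (Finset.mem_insert_of_mem h0) hQ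
    have h2 := ih P (insert k Q) _ _ ρ (fun r => (χ r, coord K k r)) hρ (hχ.insert_coord (hKS k))
      (fun j => by have := hPQ j; simp only [Finset.mem_insert] at this ⊢; tauto)
      (fun j hj => by
        have := hU j (Finset.mem_insert_of_mem hj)
        refine ⟨this.1, fun h => ?_⟩
        rcases Finset.mem_insert.1 h with h | h
        · exact hkU (h ▸ hj)
        · exact this.2 h)
      (by rw [Finset.card_insert_of_notMem hkQ]; omega) h0 (Finset.insert_nonempty _ _)
    set Y := (722 * (m * K ^ 2 : ℝ)) ^ U.card * (40 * √m * leafBound d n J) with hY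
    have hY0 : 0 ≤ Y := mul_nonneg (by positivity) hX
    calc momentNorm m (correlation (hyperbolicSlab d n J) f ρ χ)
        ≤ 2 * Y + 720 * m * K ^ 2 * Y :=
          (momentNorm_correlation_le hf hm (hKS k) ρ χ).trans (by gcongr)
      _ ≤ 722 * (m * K ^ 2) * Y := by nlinarith
      _ = _ := by rw [hY]; ring

/-- Only the branch that always chooses rows lacks the gain. It must not meet the factor `m K²`, and
costs just `2` per coordinate; each departure from it is handled by the previous lemma. -/
theorem momentNorm_correlation_le_of_empty (hf : IsFlipSystem (hyperbolicSlab d n J) f τ)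
    (hd : 3 ≤ d) {m K : ℕ} (hm : 2 ≤ m) (hK : n < 2 ^ K) (hK1 : 1 ≤ K) (hl : l ≠ 0)
    (hJ : J.card ≤ n + 1) (U : Finset (Fin d)) :
    ∀ (P : Finset (Fin d)) (V A : Type) [Fintype V] [Fintype A] [DecidableEq V] [DecidableEq A]
      (ρ : (Fin d → ℕ) → V) (χ : (Fin d → ℕ) → A),
      HasKernel (hyperbolicSlab d n J) ρ P → HasKernel (hyperbolicSlab d n J) χ ∅ →
      (∀ k, k ∈ P ∨ k ∈ U ∨ k = l) → (∀ k ∈ U, k ∉ P) →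
      P.card + U.card = d - 1 → (0 : Fin d) ∈ P →
      momentNorm m (correlation (hyperbolicSlab d n J) f ρ χ) ≤
        2 ^ U.card * (J.card * (n + 1 : ℝ) ^ (d - 2)) +
        U.card * ((722 * (m * K ^ 2)) ^ U.card * (40 * √m * leafBound d n J)) := by
  have hKS : ∀ k, ∀ r ∈ hyperbolicSlab d n J, r k < 2 ^ K := fun k r hr => by
    have := lt_of_mem_hyperbolicSlab hr k
    omega
  have hy : (1 : ℝ) ≤ m * K ^ 2 := by
    exact_mod_cast Nat.mul_pos (by omega : 0 < m) (by positivity)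
  have hX : 0 ≤ 40 * √(m : ℝ) * leafBound d n J := mul_nonneg (by positivity) leafBound_nonneg
  induction U using Finset.induction_on with
  | empty =>
    intro P V A _ _ _ _ ρ χ hρ hχ hPU _ hcard h0
    simp only [Finset.card_empty, pow_zero, one_mul, Nat.cast_zero, zero_mul, add_zero]
    refine momentNorm_le_of_abs_le (by omega) fun ω => ?_
    rw [correlation, abs_of_nonneg (gramNorm_nonneg _)]
    -- Here the row determines the vector, so the row pairs are the diagonal ones and their number
    -- is at most that of the slab.
    refine (gramNorm_entry_le_card fun r hr => hf.sq_eq_one r hr ω).trans ?_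
    have h1 := card_rowPairs_le (Q := ∅) (l := l) hρ (by simpa using hPU)
    simp only [Finset.card_empty, pow_zero, one_mul] at h1
    exact_mod_cast h1.trans (card_hyperbolicSlab_le hl)
  | insert k U hkU ih =>
    intro P V A _ _ _ _ ρ χ hρ hχ hPU hU hcard h0
    have hkP := hU k (Finset.mem_insert_self _ _)
    rw [Finset.card_insert_of_notMem hkU] at hcard ⊢
    have h1 := ih (insert k P) _ _ (fun r => (ρ r, coord K k r)) χ (hρ.insert_coord (hKS k)) hχ
      (fun j => by have := hPU j; simp only [Finset.mem_insert] at this ⊢; tauto)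
      (fun j hj h => by
        rcases Finset.mem_insert.1 h with h | h
        · exact hkU (h ▸ hj)
        · exact hU j (Finset.mem_insert_of_mem hj) h)
      (by rw [Finset.card_insert_of_notMem hkP]; omega) (Finset.mem_insert_of_mem h0)
    have h2 := momentNorm_correlation_le_of_nonempty hf hd hm hK hK1 hl hJ U P (insert k ∅) _ _ ρ
      (fun r => (χ r, coord K k r)) hρ (hχ.insert_coord (hKS k))
      (fun j => by have := hPU j; simp only [Finset.mem_insert] at this ⊢; tauto)
      (fun j hj => by
        refine ⟨hU j (Finset.mem_insert_of_mem hj), fun h => ?_⟩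
        rcases Finset.mem_insert.1 h with h | h
        · exact hkU (h ▸ hj)
        · simp at h)
      (by simp; omega) h0 (Finset.insert_nonempty _ _)
    set Y := (722 * (m * K ^ 2 : ℝ)) ^ U.card * (40 * √m * leafBound d n J) with hY
    have hY0 : 0 ≤ Y := mul_nonneg (by positivity) hX
    set Z := (2 : ℝ) ^ U.card * (J.card * (n + 1 : ℝ) ^ (d - 2)) with hZ
    have e1 : (2 : ℝ) ^ (U.card + 1) * (J.card * (n + 1 : ℝ) ^ (d - 2)) = 2 * Z := by
      rw [hZ]; ring
    have e2 : (722 * (m * K ^ 2 : ℝ)) ^ (U.card + 1) * (40 * √m * leafBound d n J) =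
      722 * (m * K ^ 2) * Y := by rw [hY]; ring
    rw [e1, e2]
    push_cast
    have hu : (0 : ℝ) ≤ U.card := by positivity
    calc momentNorm m (correlation (hyperbolicSlab d n J) f ρ χ)
        ≤ 2 * (Z + U.card * Y) + 720 * m * K ^ 2 * Y :=
          (momentNorm_correlation_le hf hm (hKS k) ρ χ).trans (by gcongr)
      _ = 2 * Z + (U.card * (2 * Y) + 720 * (m * K ^ 2) * Y) := by ring
      _ ≤ 2 * Z + (U.card * (722 * (m * K ^ 2) * Y) + 722 * (m * K ^ 2) * Y) := by
          have h3 : 2 * Y ≤ 722 * (m * K ^ 2) * Y := by gcongr; linarith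
          have h4 : 720 * (m * K ^ 2 : ℝ) * Y ≤ 722 * (m * K ^ 2) * Y := by gcongr; norm_num
          gcongr
      _ = _ := by ring

/-- The moment estimate for the block sums of a flip system. -/
theorem momentNorm_sum_sq_le (hf : IsFlipSystem (hyperbolicSlab d n J) f τ)
    (hd : 3 ≤ d) {m K : ℕ} (hm : 2 ≤ m) (hK : n < 2 ^ K) (hK1 : 1 ≤ K) (hJ : J.card ≤ n + 1) :
    momentNorm m (fun ω => ∑ r ∈ hyperbolicSlab d n J, f ω r) ^ 2 ≤ 360 * m *
      (2 ^ (d - 2) * (J.card * (n + 1 : ℝ) ^ (d - 2)) +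
        (d - 2 : ℕ) * ((722 * (m * K ^ 2)) ^ (d - 2) * (40 * √m * leafBound d n J))) := by
  have hKS : ∀ k, ∀ r ∈ hyperbolicSlab d n J, r k < 2 ^ K := fun k r hr => by
    have := lt_of_mem_hyperbolicSlab hr k
    omega
  -- The redundant coordinate must differ from `0`, since the estimates use that coordinate `0` is
  -- confined to `J`.
  set l : Fin d := ⟨1, by omega⟩ with hl
  have hl0 : l ≠ 0 := by
    intro h
    have := congrArg Fin.val h
    simp [hl] at this
  have hUcard : ((Finset.univ.erase (0 : Fin d)).erase l).card = d - 2 := by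
    rw [Finset.card_erase_of_mem (Finset.mem_erase.2 ⟨hl0, Finset.mem_univ _⟩),
      Finset.card_erase_of_mem (Finset.mem_univ _), Finset.card_univ, Fintype.card_fin]
    omega
  have key := momentNorm_correlation_le_of_empty hf hd hm hK hK1 hl0 hJ
    ((Finset.univ.erase (0 : Fin d)).erase l) {0} (Fin (2 ^ K)) Unit (coord K 0) (fun _ => ())
    (fun r hr s hs => by
      rw [coord_eq_iff (hKS 0 r hr), coord, Fin.val_ofNat, Nat.mod_eq_of_lt (hKS 0 s hs)]
      simp)
    (fun r hr s hs => by simp)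
    (fun k => by simp; tauto) (fun k hk => by simp at hk ⊢; tauto)
    (by rw [hUcard, Finset.card_singleton]; omega) (Finset.mem_singleton_self _)
  rw [hUcard] at key
  set S := hyperbolicSlab d n J with hS
  have h1 : momentNorm m (fun _ : Ω => (1 : ℝ)) ≤ 1 :=
    momentNorm_le_of_abs_le (by omega) fun _ => by simp
  -- With a single column the Gram matrix is a scalar, the square function itself.
  have hlp := momentNorm_sq_le_of_square_function (ι := Unit) hm (2 ^ K)
    (fun c _ ω => ∑ r ∈ S with r 0 = c, f ω r) (τ 0)
    (fun c _ c' hc' _ ω => Finset.sum_congr rfl fun r hr => by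
      rw [Finset.mem_filter] at hr
      exact hf.fix r hr.1 0 c (by omega) ω)
    (fun c _ _ ω => by
      rw [← Finset.sum_neg_distrib]
      refine Finset.sum_congr rfl fun r hr => ?_
      rw [Finset.mem_filter] at hr
      rw [← hr.2]
      exact hf.odd r hr.1 0 ω)
    (fun ω => ∑ r ∈ S, f ω r) (correlation S f (coord K 0) (fun _ => ())) (fun _ => 1)
    (fun ω => by
      simp only [Finset.univ_unique, Finset.sum_singleton]
      rw [Finset.sum_fiberwise_of_maps_to fun r hr => Finset.mem_range.2 (hKS 0 r hr)])
    (fun ω => by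
      have hent : ∀ c : Fin (2 ^ K), entry S (f ω) (coord K 0) (fun _ => ()) c () =
          ∑ r ∈ S with r 0 = (c : ℕ), f ω r := fun c => by
        refine Finset.sum_congr (Finset.filter_congr fun r hr => ?_) fun _ _ => rfl
        rw [coord_eq_iff (hKS 0 r hr)]
        simp
      simp only [Finset.univ_unique, Finset.sum_singleton, correlation, gramNorm, mul_one]
      rw [Real.sqrt_sq (Finset.sum_nonneg fun c _ => mul_self_nonneg _)]
      refine le_of_eq ?_
      rw [← Fin.sum_univ_eq_sum_range (fun c => (∑ r ∈ S with r 0 = c, f ω r) ^ 2)]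
      exact Finset.sum_congr rfl fun c _ => by rw [← hent, sq])
  refine hlp.trans ?_
  have h0 := momentNorm_nonneg m (correlation S f (coord K 0) (fun _ => ()))
  gcongr
  calc _ ≤ momentNorm m (correlation S f (coord K 0) (fun _ => ())) * 1 := by gcongr
    _ ≤ _ := by rw [mul_one]; exact key

end Induction

/-! ### Binary digits as a finite model of the unit cube -/

/-- The sign attached to the last digit of a natural number. -/
def digitSign (e : ℕ) : ℝ := if e % 2 = 1 then 1 else -1

theorem digitSign_sq (e : ℕ) : digitSign e ^ 2 = 1 := by
  unfold digitSign; split_ifs <;> norm_num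

theorem digitSign_xor_one (e : ℕ) : digitSign (e ^^^ 1) = -digitSign e := by
  unfold digitSign
  rw [Nat.xor_mod_two_eq]
  rcases Nat.mod_two_eq_zero_or_one e with h | h
  · rw [if_pos (by omega), if_neg (by omega), neg_neg]
  · rw [if_neg (by omega), if_pos h]

theorem xor_one_div_two (e : ℕ) : (e ^^^ 1) / 2 = e / 2 := by
  have := Nat.xor_div_two_pow (a := e) (b := 1) (n := 1)
  simpa using this

/-- The floor is the index of the dyadic half-interval containing `x`: its half locates the
interval, its parity tells left from right. -/
theorem haar_eq_digitSign (I : DyadicInterval) {x : ℝ} (hx : 0 ≤ x) :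
    I.haar x = if ⌊2 ^ (I.scale + 1) * x⌋₊ / 2 = I.pos then
      digitSign ⌊2 ^ (I.scale + 1) * x⌋₊ else 0 := by
  set e := ⌊2 ^ (I.scale + 1) * x⌋₊ with he
  have hy : (0 : ℝ) ≤ 2 ^ (I.scale + 1) * x := by positivity
  have h2 : (0 : ℝ) < 2 ^ I.scale := by positivity
  have h1 : x ∈ Set.Ico I.left I.mid ↔ e = 2 * I.pos := by
    rw [he, Nat.floor_eq_iff hy, Set.mem_Ico, DyadicInterval.left, DyadicInterval.mid,
      div_le_iff₀ h2, lt_div_iff₀ h2, pow_succ]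
    push_cast
    constructor <;> rintro ⟨h3, h4⟩ <;> constructor <;> linarith
  have h3 : x ∈ Set.Ico I.mid I.right ↔ e = 2 * I.pos + 1 := by
    rw [he, Nat.floor_eq_iff hy, Set.mem_Ico, DyadicInterval.right, DyadicInterval.mid,
      div_le_iff₀ h2, lt_div_iff₀ h2, pow_succ]
    push_cast
    constructor <;> rintro ⟨h3, h4⟩ <;> constructor <;> linarith
  unfold DyadicInterval.haar
  simp only [Set.indicator_apply, h1, h3, Pi.one_apply, digitSign]
  split_ifs <;> first | omega | norm_num

/-- The function `f_r` in terms of the first `n + 1` binary digits of the coordinates, each being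
encoded as a natural number below `2 ^ (n + 1)`. -/
noncomputable def digitFun {d : ℕ} (n : ℕ) (α : DyadicRectangle d → ℝ)
    (ω : Fin d → Fin (2 ^ (n + 1))) (r : Fin d → ℕ) : ℝ :=
  α (fun k => ⟨r k, Fin.ofNat (2 ^ r k) ((ω k : ℕ) / 2 ^ (n - r k) / 2)⟩) *
    ∏ k, digitSign ((ω k : ℕ) / 2 ^ (n - r k))

/-- The first `n + 1` binary digits of the coordinates. -/
noncomputable def digits {d : ℕ} (n : ℕ) (x : Fin d → ℝ) : Fin d → Fin (2 ^ (n + 1)) :=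
  fun k => Fin.ofNat (2 ^ (n + 1)) ⌊2 ^ (n + 1) * x k⌋₊

theorem digits_val {d n : ℕ} {x : Fin d → ℝ} {k : Fin d} (hx1 : x k < 1) :
    (digits n x k : ℕ) = ⌊2 ^ (n + 1) * x k⌋₊ := by
  rw [digits, Fin.val_ofNat, Nat.mod_eq_of_lt]
  rw [Nat.floor_lt' (by positivity)]
  push_cast
  have : (0 : ℝ) < 2 ^ (n + 1) := by positivity
  nlinarith

theorem floor_eq_digits_div {d n : ℕ} {x : Fin d → ℝ} {k : Fin d} (hx1 : x k < 1) {c : ℕ}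
    (hc : c ≤ n) : ⌊2 ^ (c + 1) * x k⌋₊ = (digits n x k : ℕ) / 2 ^ (n - c) := by
  rw [digits_val hx1, ← Nat.floor_div_natCast]
  congr 1
  push_cast
  rw [eq_div_iff (by positivity), mul_right_comm, ← pow_add]
  congr 2
  omega

/-- For a given scale vector exactly one rectangle contains the point, so the sum has one nonzero
term. -/
theorem rFun_eq_digitFun {d n : ℕ} (α : DyadicRectangle d → ℝ) {r : Fin d → ℕ}
    (hr : ∀ k, r k ≤ n) {x : Fin d → ℝ} (hx0 : ∀ k, 0 ≤ x k) (hx1 : ∀ k, x k < 1) :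
    rFun α r x = digitFun n α (digits n x) r := by
  have hlt : ∀ k, (digits n x k : ℕ) / 2 ^ (n - r k) / 2 < 2 ^ r k := by
    intro k
    rw [Nat.div_div_eq_div_mul, Nat.div_lt_iff_lt_mul (by positivity), ← pow_succ, ← pow_add]
    have := (digits n x k).2
    rwa [show r k + (n - r k + 1) = n + 1 by have := hr k; omega]
  have hh : ∀ j : (∀ k, Fin (2 ^ r k)), haarRect (fun k => ⟨r k, j k⟩) x =
      if j = (fun k => Fin.ofNat (2 ^ r k) ((digits n x k : ℕ) / 2 ^ (n - r k) / 2)) then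
        ∏ k, digitSign ((digits n x k : ℕ) / 2 ^ (n - r k)) else 0 := by
    intro j
    have h1 : ∀ k, (⟨r k, j k⟩ : DyadicInterval).haar (x k) =
        if (digits n x k : ℕ) / 2 ^ (n - r k) / 2 = j k then
          digitSign ((digits n x k : ℕ) / 2 ^ (n - r k)) else 0 := by
      intro k
      rw [haar_eq_digitSign _ (hx0 k)]
      simp only []
      rw [floor_eq_digits_div (hx1 k) (hr k)]
    unfold haarRect
    simp only [h1]
    split_ifs with hj
    · refine Finset.prod_congr rfl fun k _ => ?_
      rw [if_pos]
      rw [hj, Fin.val_ofNat, Nat.mod_eq_of_lt (hlt k)]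
    · obtain ⟨k, hk⟩ := Function.ne_iff.1 hj
      refine Finset.prod_eq_zero (Finset.mem_univ k) (if_neg fun h => hk ?_)
      rw [Fin.ext_iff, Fin.val_ofNat, Nat.mod_eq_of_lt (hlt k), h]
  unfold rFun digitFun
  simp only [hh, mul_ite, mul_zero]
  rw [Finset.sum_ite_eq' Finset.univ]
  simp

/-- The flip of the digit of the value `2 ^ b` of a number with `N` binary digits. -/
def flipDigit {N b : ℕ} (hb : b < N) : Fin (2 ^ N) ≃ Fin (2 ^ N) :=
  Function.Involutive.toPerm
    (fun w => ⟨w ^^^ 2 ^ b, Nat.xor_lt_two_pow w.2 (Nat.pow_lt_pow_right (by norm_num) hb)⟩)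
    (fun w => by ext; simp)

theorem flipDigit_val {N b : ℕ} (hb : b < N) (w : Fin (2 ^ N)) :
    (flipDigit hb w : ℕ) = w ^^^ 2 ^ b := rfl

theorem flipDigit_div_of_lt {N b b' : ℕ} (hb : b < N) (hbb : b < b') (w : Fin (2 ^ N)) :
    (flipDigit hb w : ℕ) / 2 ^ b' = w / 2 ^ b' := by
  rw [flipDigit_val, Nat.xor_div_two_pow,
    Nat.div_eq_of_lt (Nat.pow_lt_pow_right (by norm_num) hbb), Nat.xor_zero]

theorem flipDigit_div_self {N b : ℕ} (hb : b < N) (w : Fin (2 ^ N)) :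
    (flipDigit hb w : ℕ) / 2 ^ b = (w / 2 ^ b) ^^^ 1 := by
  rw [flipDigit_val, Nat.xor_div_two_pow, Nat.div_self (by positivity)]

/-- The flip of the `c`-th digit of the `k`-th coordinate. -/
def flip {d : ℕ} (n : ℕ) (k : Fin d) (c : ℕ) :
    (Fin d → Fin (2 ^ (n + 1))) ≃ (Fin d → Fin (2 ^ (n + 1))) :=
  Equiv.piCongrRight fun k' => if k' = k ∧ c ≤ n then flipDigit (b := n - c) (by omega)
    else Equiv.refl _

theorem flip_apply_ne {d n : ℕ} {k k' : Fin d} (h : k' ≠ k) (c : ℕ)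
    (ω : Fin d → Fin (2 ^ (n + 1))) : flip n k c ω k' = ω k' := by
  simp [flip, h]

theorem flip_apply_self {d n : ℕ} {k : Fin d} {c : ℕ} (hc : c ≤ n)
    (ω : Fin d → Fin (2 ^ (n + 1))) :
    flip n k c ω k = flipDigit (b := n - c) (by omega) (ω k) := by
  simp [flip, hc]

theorem flip_of_lt {d n : ℕ} {k : Fin d} {c : ℕ} (hc : n < c)
    (ω : Fin d → Fin (2 ^ (n + 1))) : flip n k c ω = ω := by
  funext k'
  simp [flip, hc.not_ge]

/-- The rectangle depends on the digits of coordinate `k` before position `r k`, and the Haar sign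
on the digit at `r k`. Flipping that digit thus changes only the sign, and later digits are not
seen. -/
theorem isFlipSystem_digitFun {d n : ℕ} [NeZero d] {J : Finset ℕ} {α : DyadicRectangle d → ℝ}
    (hα : ∀ R, ∑ k, (R k).scale = n → α R = 1 ∨ α R = -1) :
    IsFlipSystem (hyperbolicSlab d n J) (digitFun n α) (flip n) where
  fix := by
    intro r hr k c hc ω
    rcases lt_or_ge n c with h | h
    · rw [flip_of_lt h]
    · have : ∀ k', (flip n k c ω k' : ℕ) / 2 ^ (n - r k') = ω k' / 2 ^ (n - r k') := by
        intro k'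
        by_cases hk : k' = k
        · subst hk
          rw [flip_apply_self h, flipDigit_div_of_lt _ (by omega)]
        · rw [flip_apply_ne hk]
      simp only [digitFun, this]
  odd := by
    intro r hr k ω
    have hle : r k ≤ n := by have := lt_of_mem_hyperbolicSlab hr k; omega
    have h1 : ∀ k', (flip n k (r k) ω k' : ℕ) / 2 ^ (n - r k') / 2 =
        ω k' / 2 ^ (n - r k') / 2 := by
      intro k'
      by_cases hk : k' = k
      · subst hk
        rw [flip_apply_self hle, flipDigit_div_self, xor_one_div_two]
      · rw [flip_apply_ne hk]
    have h2 : ∏ k', digitSign ((flip n k (r k) ω k' : ℕ) / 2 ^ (n - r k')) =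
        -∏ k', digitSign (ω k' / 2 ^ (n - r k')) := by
      rw [← Finset.mul_prod_erase _ _ (Finset.mem_univ k),
        ← Finset.mul_prod_erase Finset.univ (fun k' => digitSign ((ω k' : ℕ) / 2 ^ (n - r k')))
          (Finset.mem_univ k), flip_apply_self hle, flipDigit_div_self, digitSign_xor_one, neg_mul]
      congr 2
      refine Finset.prod_congr rfl fun k' hk' => ?_
      rw [flip_apply_ne (Finset.ne_of_mem_erase hk')]
    simp only [digitFun, h1, h2, mul_neg]
  sq_eq_one := by
    intro r hr ω
    rw [digitFun, mul_pow, ← Finset.prod_pow]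
    simp only [digitSign_sq, Finset.prod_const_one, mul_one]
    rcases hα (fun k => ⟨r k, Fin.ofNat (2 ^ r k) ((ω k : ℕ) / 2 ^ (n - r k) / 2)⟩)
      (mem_hyperbolicSlab.1 hr).1 with h | h <;> rw [h] <;> norm_num

theorem blockSum_eq_sum_digitFun {d n : ℕ} [NeZero d] {J : Finset ℕ} (α : DyadicRectangle d → ℝ)
    {x : Fin d → ℝ} (hx0 : ∀ k, 0 ≤ x k) (hx1 : ∀ k, x k < 1) :
    blockSum n J α x = ∑ r ∈ hyperbolicSlab d n J, digitFun n α (digits n x) r :=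
  Finset.sum_congr rfl fun _ hr => rFun_eq_digitFun α
    (fun k => by have := lt_of_mem_hyperbolicSlab hr k; omega) hx0 hx1

theorem cubeMeasure_eq (d : ℕ) :
    cubeMeasure d = volume.restrict (Set.univ.pi fun _ => Set.Ico (0 : ℝ) 1) :=
  (Measure.restrict_congr_set (Measure.univ_pi_Ico_ae_eq_Icc (μ := fun _ : Fin d => volume))).symm

theorem ae_cubeMeasure (d : ℕ) : ∀ᵐ x ∂cubeMeasure d, ∀ k, 0 ≤ x k ∧ x k < 1 := by
  rw [cubeMeasure_eq, ae_restrict_iff' (MeasurableSet.univ_pi fun _ => measurableSet_Ico)]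
  exact Filter.Eventually.of_forall fun x hx k => hx k (Set.mem_univ k)

instance (d : ℕ) : IsProbabilityMeasure (cubeMeasure d) :=
  ⟨by rw [cubeMeasure_eq, Measure.restrict_apply_univ, Real.volume_pi_Ico]; simp⟩

theorem measurable_digits (d n : ℕ) : Measurable (digits n : (Fin d → ℝ) → _) := by
  refine measurable_pi_lambda _ fun k => ?_
  exact (measurable_from_nat (f := Fin.ofNat (2 ^ (n + 1)))).comp
    (Nat.measurable_floor.comp (measurable_const.mul (measurable_pi_apply k)))

/-- The points of the cube with given digits form a dyadic cube of side `2^(-(n+1))`, so the digits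
are uniformly distributed. -/
theorem map_digits_singleton {d n : ℕ} (ω : Fin d → Fin (2 ^ (n + 1))) :
    (cubeMeasure d).map (digits n) {ω} =
      ENNReal.ofReal (1 / Fintype.card (Fin d → Fin (2 ^ (n + 1)))) := by
  rw [Measure.map_apply (measurable_digits d n) (measurableSet_singleton ω), cubeMeasure_eq,
    Measure.restrict_apply (measurable_digits d n (measurableSet_singleton ω))]
  have hp : (0 : ℝ) < 2 ^ (n + 1) := by positivity
  have hset : digits n ⁻¹' {ω} ∩ (Set.univ.pi fun _ => Set.Ico (0 : ℝ) 1) =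
      Set.univ.pi fun k => Set.Ico ((ω k : ℝ) / 2 ^ (n + 1)) (((ω k : ℝ) + 1) / 2 ^ (n + 1)) := by
    ext x
    simp only [Set.mem_inter_iff, Set.mem_preimage, Set.mem_singleton_iff, Set.mem_univ_pi,
      Set.mem_Ico]
    have hω : ∀ k, ((ω k : ℕ) : ℝ) + 1 ≤ 2 ^ (n + 1) := fun k => by exact_mod_cast (ω k).2
    constructor
    · rintro ⟨h1, h2⟩ k
      have h3 := digits_val (n := n) (h2 k).2
      rw [h1, eq_comm, Nat.floor_eq_iff (mul_nonneg hp.le (h2 k).1)] at h3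
      rw [div_le_iff₀ hp, lt_div_iff₀ hp, mul_comm]
      exact h3
    · intro h
      have hx : ∀ k, 0 ≤ x k ∧ x k < 1 := fun k =>
        ⟨le_trans (by positivity) (h k).1, (h k).2.trans_le ((div_le_one hp).2 (hω k))⟩
      refine ⟨?_, hx⟩
      funext k
      rw [Fin.ext_iff, digits_val (hx k).2, Nat.floor_eq_iff (mul_nonneg hp.le (hx k).1), mul_comm,
        ← div_le_iff₀ hp, ← lt_div_iff₀ hp]
      exact h k
  rw [hset, Real.volume_pi_Ico]
  have : ∀ k, ((ω k : ℝ) + 1) / 2 ^ (n + 1) - (ω k : ℝ) / 2 ^ (n + 1) = 1 / 2 ^ (n + 1) := by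
    intro k; ring
  simp only [this]
  rw [Finset.prod_const, ← ENNReal.ofReal_pow (by positivity)]
  simp

theorem eLpNorm_comp_digits {d n m : ℕ} (hm : 1 ≤ m) (F : (Fin d → Fin (2 ^ (n + 1))) → ℝ) :
    eLpNorm (fun x => F (digits n x)) (ENNReal.ofReal (2 * m)) (cubeMeasure d) =
      ENNReal.ofReal (momentNorm m F) := by
  have hm' : (0 : ℝ) < 2 * m := by positivity
  have hF : AEStronglyMeasurable F ((cubeMeasure d).map (digits n)) :=
    (Measurable.of_discrete (f := F)).aestronglyMeasurable
  have h1 := eLpNorm_map_measure (p := ENNReal.ofReal (2 * m)) hF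
    (measurable_digits d n).aemeasurable
  have h2 : (F ∘ digits n) = fun x => F (digits n x) := rfl
  rw [← h2, ← h1, eLpNorm_eq_lintegral_rpow_enorm_toReal (ENNReal.ofReal_pos.2 hm').ne'
      ENNReal.ofReal_ne_top,
    ENNReal.toReal_ofReal hm'.le, lintegral_fintype]
  unfold momentNorm
  rw [← ENNReal.ofReal_rpow_of_nonneg (by positivity) (by positivity),
    Finset.sum_div, ENNReal.ofReal_sum_of_nonneg fun _ _ => by positivity]
  congr 1
  refine Finset.sum_congr rfl fun ω _ => ?_
  rw [map_digits_singleton, div_eq_mul_one_div (|F ω| ^ (2 * m)), ENNReal.ofReal_mul (by positivity)]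
  congr 1
  rw [← Real.rpow_natCast, ← ENNReal.ofReal_rpow_of_nonneg (abs_nonneg _) (by positivity),
    ← Real.norm_eq_abs, ofReal_norm]
  push_cast
  rfl

/-! ### Choice of parameters and the normalized moment bound -/

theorem exists_natLog_pow_le (D : ℕ) (hD : 1 ≤ D) (θ : ℝ) (hθ : 0 < θ) :
    ∃ C : ℝ, 0 < C ∧ ∀ n : ℕ, 1 ≤ n → ((Nat.log 2 n + 1 : ℕ) : ℝ) ^ D ≤ C * (n : ℝ) ^ θ := by
  set δ : ℝ := θ / D with hδ
  have hD0 : (0 : ℝ) < D := by exact_mod_cast hD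
  have hδ0 : 0 < δ := by positivity
  have hlog2 : 0 < Real.log 2 := Real.log_pos (by norm_num)
  refine ⟨(1 / (δ * Real.log 2) + 1) ^ D, by positivity, fun n hn => ?_⟩
  have hn1 : (1 : ℝ) ≤ n := by exact_mod_cast hn
  have h1 : (Nat.log 2 n : ℝ) ≤ Real.logb 2 n := by
    simpa using Real.natLog_le_logb n 2
  have h2 : Real.logb 2 n ≤ (n : ℝ) ^ δ / (δ * Real.log 2) := by
    rw [Real.logb, ← div_div]
    gcongr
    exact Real.log_le_rpow_div (by positivity) hδ0
  have h3 : 1 ≤ (n : ℝ) ^ δ := Real.one_le_rpow hn1 hδ0.le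
  have h4 : ((Nat.log 2 n + 1 : ℕ) : ℝ) ≤ (1 / (δ * Real.log 2) + 1) * (n : ℝ) ^ δ := by
    push_cast
    calc (Nat.log 2 n : ℝ) + 1 ≤ (n : ℝ) ^ δ / (δ * Real.log 2) + (n : ℝ) ^ δ := by linarith
      _ = _ := by ring
  calc ((Nat.log 2 n + 1 : ℕ) : ℝ) ^ D ≤ ((1 / (δ * Real.log 2) + 1) * (n : ℝ) ^ δ) ^ D := by gcongr
    _ = _ := by
      rw [mul_pow, ← Real.rpow_natCast ((n : ℝ) ^ δ), ← Real.rpow_mul (by positivity), hδ,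
        div_mul_cancel₀ _ hD0.ne']

/-- The exponent of `n` in `q` is below `1/2`. Hence `n / q` is at least a power of `n`, and powers
of `log n` can be absorbed into powers of `n / q`. -/
theorem sqrt_le_div_blockCount {d n q : ℕ} (hd : 3 ≤ d) (hn : 1 ≤ n) {a κ : ℝ} (ha : 0 < a)
    (ha1 : a < 1) (hκ : 0 < κ) (hq : q = blockCount d n a κ) (hq1 : 1 ≤ q) :
    √(n : ℝ) ≤ (n : ℝ) / q := by
  have hn1 : (1 : ℝ) ≤ n := by exact_mod_cast hn
  have hd' : (3 : ℝ) ≤ d := by exact_mod_cast hd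
  have hq0 : (0 : ℝ) < q := by exact_mod_cast hq1
  have h1 : (q : ℝ) ≤ √(n : ℝ) := by
    calc (q : ℝ) ≤ a * (n : ℝ) ^ (1 / (2 * (d : ℝ)) - κ) := by
          rw [hq]; exact Nat.floor_le (by positivity)
      _ ≤ 1 * (n : ℝ) ^ (1 / 2 : ℝ) := by
          gcongr
          have : 1 / (2 * (d : ℝ)) ≤ 1 / 2 := by gcongr; linarith
          linarith
      _ = √(n : ℝ) := by rw [one_mul, Real.sqrt_eq_rpow]
  rw [le_div_iff₀ hq0]
  calc √(n : ℝ) * q ≤ √(n : ℝ) * √(n : ℝ) := by gcongr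
    _ = n := Real.mul_self_sqrt (by positivity)

theorem card_le_of_isEqualDivision {n q : ℕ} {I : Fin q → Finset ℕ} (hI : IsEqualDivision n q I)
    (t : Fin q) : (I t).card ≤ n / q + 1 := by
  obtain ⟨b, _, _, hb⟩ := hI
  obtain ⟨h1, h2⟩ := hb t
  rw [h1, Nat.card_Ioc]
  generalize n / q = w at h2 ⊢
  omega

/-- `ρ⁻²` is exactly the order of the main term: block length times `n^(d-2)`. -/
theorem rho_sq {d n q : ℕ} (hd : 3 ≤ d) (hn : 1 ≤ n) (hq : 1 ≤ q) :
    rho d n q ^ 2 * ((n : ℝ) / q * (n : ℝ) ^ (d - 2)) = 1 := by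
  have hn0 : (0 : ℝ) < n := by exact_mod_cast hn
  have hq0 : (0 : ℝ) < q := by exact_mod_cast hq
  have h1 : ((n : ℝ) ^ (-(((d : ℝ) - 1) / 2))) ^ 2 = ((n : ℝ) ^ (d - 1))⁻¹ := by
    rw [← Real.rpow_natCast, ← Real.rpow_mul hn0.le, ← Real.rpow_natCast, ← Real.rpow_neg hn0.le]
    congr 1
    rw [Nat.cast_sub (by omega)]
    push_cast
    ring
  have h2 : (n : ℝ) ^ (d - 1) = n * (n : ℝ) ^ (d - 2) := by
    rw [← pow_succ']; congr 1; omega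
  rw [rho, mul_pow, Real.sq_sqrt hq0.le, h1, h2]
  field_simp

/-- The numerical estimate that turns the moment estimate into a Gaussian one, with
`lam = Lam ^ (1 / (2 d - 1))`. -/
theorem moment_bound_le {d m K L : ℕ} (hd : 3 ≤ d) {Lam lam C B : ℝ} (hlam : 0 ≤ lam)
    (hLam : lam ^ (2 * d - 1) = Lam) (hB : 0 ≤ B)
    (hC : 0 < C) (hL : (L : ℝ) ≤ 2 * Lam) (hm : (m : ℝ) ≤ 4 * lam)
    (hK : (K : ℝ) ^ (2 * (d - 2)) ≤ C * lam) :
    2 ^ (d - 2) * (L * B) + (d - 2 : ℕ) * ((722 * (m * K ^ 2)) ^ (d - 2) * (40 * √m * (√L * B))) ≤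
      (2 * 2 ^ (d - 2) + (d - 2 : ℕ) * 2888 ^ (d - 2) * 160 * C) * (Lam * B) := by
  have hLam0 : 0 ≤ Lam := by rw [← hLam]; positivity
  have h1 : √(m : ℝ) ≤ 2 * √lam := by
    rw [Real.sqrt_le_left (by positivity), mul_pow, Real.sq_sqrt hlam]
    linarith
  have h2 : √(L : ℝ) ≤ 2 * √Lam := by
    rw [Real.sqrt_le_left (by positivity), mul_pow, Real.sq_sqrt hLam0]
    linarith
  -- This identity fixes the exponent `2 d - 1`: `m^(d-2)` from the recursion, one `lam` for the
  -- logarithms, and `√m` from the leaf together use up the gain `√Lam`.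
  have h3 : lam ^ (d - 2) * lam * √lam = √Lam := by
    rw [← pow_succ, ← hLam]
    have : lam ^ (2 * d - 1) = (lam ^ (d - 2 + 1)) ^ 2 * lam := by
      rw [← pow_mul, ← pow_succ]; congr 1; omega
    rw [this, Real.sqrt_mul (by positivity), Real.sqrt_sq (by positivity)]
  have h4 : (722 * (m * K ^ 2) : ℝ) ^ (d - 2) ≤ 2888 ^ (d - 2) * lam ^ (d - 2) * (C * lam) := by
    calc (722 * (m * K ^ 2) : ℝ) ^ (d - 2) = (722 * m) ^ (d - 2) * (K : ℝ) ^ (2 * (d - 2)) := by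
          rw [pow_mul, ← mul_pow, mul_assoc]
      _ ≤ (722 * (4 * lam)) ^ (d - 2) * (C * lam) := by gcongr
      _ = _ := by rw [← mul_assoc 722, mul_pow]; norm_num
  have h5 : (722 * (m * K ^ 2) : ℝ) ^ (d - 2) * (40 * √m * (√L * B)) ≤
      2888 ^ (d - 2) * 160 * C * (Lam * B) := by
    calc (722 * (m * K ^ 2) : ℝ) ^ (d - 2) * (40 * √m * (√L * B))
        ≤ 2888 ^ (d - 2) * lam ^ (d - 2) * (C * lam) * (40 * (2 * √lam) * (2 * √Lam * B)) := by
          gcongr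
      _ = 2888 ^ (d - 2) * 160 * C * ((lam ^ (d - 2) * lam * √lam) * √Lam * B) := by ring
      _ = _ := by rw [h3, Real.mul_self_sqrt hLam0]
  calc _ ≤ 2 ^ (d - 2) * (2 * Lam * B) +
        (d - 2 : ℕ) * (2888 ^ (d - 2) * 160 * C * (Lam * B)) := by gcongr
    _ = _ := by ring

theorem exists_eLpNorm_blockSum_le (d : ℕ) [NeZero d] (hd : 3 ≤ d) :
    ∃ C : ℝ, 0 < C ∧ ∀ (n : ℕ) (_ : 1 ≤ n) (a κ : ℝ) (_ : 0 < a) (_ : a < 1) (_ : 0 < κ)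
      (q : ℕ) (_ : q = blockCount d n a κ) (I : Fin q → Finset ℕ) (_ : IsEqualDivision n q I)
      (α : DyadicRectangle d → ℝ) (_ : ∀ R, ∑ k, (R k).scale = n → α R = 1 ∨ α R = -1)
      (t : Fin q) (m : ℕ) (_ : 2 ≤ m)
      (_ : (m : ℝ) ≤ 4 * ((n : ℝ) / q) ^ (1 / (2 * (d : ℝ) - 1))),
      eLpNorm (fun x => rho d n q * blockSum n (I t) α x) (ENNReal.ofReal (2 * m))
        (cubeMeasure d) ≤ ENNReal.ofReal (C * √m) := by
  have hd' : (3 : ℝ) ≤ d := by exact_mod_cast hd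
  have hexp : 0 < 1 / (2 * (d : ℝ) - 1) := by
    apply div_pos one_pos; linarith
  obtain ⟨C₁, hC₁, hlog⟩ := exists_natLog_pow_le (2 * (d - 2)) (by omega)
    (1 / 2 * (1 / (2 * (d : ℝ) - 1))) (by positivity)
  set C₂ : ℝ := 2 * 2 ^ (d - 2) + (d - 2 : ℕ) * 2888 ^ (d - 2) * 160 * C₁ with hC₂
  have hC₂0 : 0 < C₂ := by positivity
  refine ⟨√(360 * C₂ * 2 ^ (d - 2)), by positivity, ?_⟩
  intro n hn a κ ha ha1 hκ q hq I hI α hα t m hm hmle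
  have hq1 : 1 ≤ q := by have := t.2; omega
  have hn0 : (0 : ℝ) < n := by exact_mod_cast hn
  have hq0 : (0 : ℝ) < q := by exact_mod_cast hq1
  have hsqrt := sqrt_le_div_blockCount hd hn ha ha1 hκ hq hq1
  set Lam : ℝ := (n : ℝ) / q with hLam
  have hLam1 : 1 ≤ Lam := le_trans (Real.one_le_sqrt.2 (by exact_mod_cast hn)) hsqrt
  set lam : ℝ := Lam ^ (1 / (2 * (d : ℝ) - 1)) with hlam
  have hlam0 : 0 ≤ lam := by positivity
  have hlampow : lam ^ (2 * d - 1) = Lam := by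
    rw [hlam, ← Real.rpow_natCast, ← Real.rpow_mul (by positivity), Nat.cast_sub (by omega)]
    push_cast
    rw [one_div_mul_cancel (by linarith), Real.rpow_one]
  set J := I t with hJdef
  have hJ := card_le_of_isEqualDivision hI t
  rw [← hJdef] at hJ
  have hJn : J.card ≤ n + 1 := hJ.trans (by have := Nat.div_le_self n q; omega)
  have hJL : (J.card : ℝ) ≤ 2 * Lam := by
    have h1 : (J.card : ℝ) ≤ ((n / q : ℕ) : ℝ) + 1 := by exact_mod_cast hJ
    have h2 : ((n / q : ℕ) : ℝ) ≤ Lam := Nat.cast_div_le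
    linarith
  set K := Nat.log 2 n + 1 with hKdef
  have hK : n < 2 ^ K := Nat.lt_pow_succ_log_self (by norm_num) n
  -- The logarithmic power is at most a multiple of `(√n)^(1/(2d-1))`, hence of `lam`, because `√n ≤
  -- Lam`.
  have hKpow : (K : ℝ) ^ (2 * (d - 2)) ≤ C₁ * lam := by
    refine (hlog n hn).trans ?_
    rw [Real.rpow_mul hn0.le, ← Real.sqrt_eq_rpow]
    exact mul_le_mul_of_nonneg_left (Real.rpow_le_rpow (Real.sqrt_nonneg _) hsqrt hexp.le) hC₁.le
  have key := momentNorm_sum_sq_le (isFlipSystem_digitFun (J := J) hα) hd hm hK (by omega) hJn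
  set F : (Fin d → Fin (2 ^ (n + 1))) → ℝ :=
    fun ω => ∑ r ∈ hyperbolicSlab d n J, digitFun n α ω r with hF
  have hbound := moment_bound_le (m := m) (K := K) (L := J.card) (B := (n + 1 : ℝ) ^ (d - 2)) hd
    hlam0 hlampow (by positivity) hC₁ hJL hmle hKpow
  have hBn : (n + 1 : ℝ) ^ (d - 2) ≤ 2 ^ (d - 2) * (n : ℝ) ^ (d - 2) := by
    rw [← mul_pow]
    gcongr
    have : (1 : ℝ) ≤ n := by exact_mod_cast hn
    linarith
  have hF2 : momentNorm m F ^ 2 ≤ 360 * m * (C₂ * (Lam * (2 ^ (d - 2) * (n : ℝ) ^ (d - 2)))) := by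
    refine key.trans ?_
    rw [leafBound]
    gcongr
    refine hbound.trans ?_
    gcongr
  have hρ0 : 0 ≤ rho d n q := by unfold rho; positivity
  have hfin : rho d n q * momentNorm m F ≤ √(360 * C₂ * 2 ^ (d - 2)) * √m := by
    rw [← Real.sqrt_mul (by positivity)]
    refine Real.le_sqrt_of_sq_le ?_
    rw [mul_pow]
    calc rho d n q ^ 2 * momentNorm m F ^ 2
        ≤ rho d n q ^ 2 * (360 * m * (C₂ * (Lam * (2 ^ (d - 2) * (n : ℝ) ^ (d - 2))))) := by gcongr
      _ = 360 * C₂ * 2 ^ (d - 2) * m * (rho d n q ^ 2 * (Lam * (n : ℝ) ^ (d - 2))) := by ring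
      _ = _ := by rw [rho_sq hd hn hq1, mul_one]
  have hae : (fun x => rho d n q * blockSum n J α x) =ᵐ[cubeMeasure d]
      rho d n q • fun x => F (digits n x) := by
    filter_upwards [ae_cubeMeasure d] with x hx
    rw [blockSum_eq_sum_digitFun α (fun k => (hx k).1) fun k => (hx k).2]
    rfl
  rw [eLpNorm_congr_ae hae, eLpNorm_const_smul, eLpNorm_comp_digits (by omega),
    Real.enorm_eq_ofReal hρ0, ← ENNReal.ofReal_mul hρ0]
  exact ENNReal.ofReal_le_ofReal hfin

theorem aestronglyMeasurable_blockSum (d n : ℕ) [NeZero d] (J : Finset ℕ)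
    (α : DyadicRectangle d → ℝ) (s : ℝ) :
    AEStronglyMeasurable (fun x => s * blockSum n J α x) (cubeMeasure d) := by
  refine ((Measurable.of_discrete (f := fun ω => s * ∑ r ∈ hyperbolicSlab d n J,
    digitFun n α ω r)).comp (measurable_digits d n)).aestronglyMeasurable.congr ?_
  filter_upwards [ae_cubeMeasure d] with x hx
  rw [blockSum_eq_sum_digitFun α (fun k => (hx k).1) fun k => (hx k).2]
  rfl

/-- A moment bound `‖g‖_p ≤ C √p` with `p = c y²` gives a Gaussian tail at `y`. -/
theorem measure_lt_abs_le_of_eLpNorm_le {Ω : Type*} [MeasurableSpace Ω] {μ : Measure Ω}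
    {g : Ω → ℝ} (hg : AEStronglyMeasurable g μ) {C c y : ℝ} (hc : 0 < c)
    (hCc : 9 * (C ^ 2 * c) ≤ 1) (hy : 0 < y)
    (h : eLpNorm g (ENNReal.ofReal (c * y ^ 2)) μ ≤ ENNReal.ofReal (C * √(c * y ^ 2))) :
    μ {x | y < |g x|} ≤ ENNReal.ofReal (Real.exp (-c * y ^ 2)) := by
  set p := c * y ^ 2 with hp
  have hp0 : 0 < p := by positivity
  have he : Real.exp 1 ≤ 3 := by linarith [Real.exp_one_lt_d9]
  -- The choice of `c` makes the norm at most `y / 3 ≤ y / e`, so Markov's inequality loses a factor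
  -- `e` per unit of `p`.
  have h1 : C * √p ≤ y * Real.exp (-1) := by
    have h2 : C * √p ≤ y / 3 := by
      refine abs_le_of_sq_le_sq' ?_ (by positivity) |>.2
      rw [mul_pow, Real.sq_sqrt hp0.le, hp, div_pow]
      nlinarith [sq_nonneg y]
    refine h2.trans ?_
    rw [Real.exp_neg, ← div_eq_mul_inv]
    gcongr
  have hM := mul_meas_ge_le_pow_eLpNorm' μ (p := ENNReal.ofReal p)
    (ENNReal.ofReal_pos.2 hp0).ne' ENNReal.ofReal_ne_top hg (ENNReal.ofReal y)
  rw [ENNReal.toReal_ofReal hp0.le] at hM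
  have hsub : {x | y < |g x|} ⊆ {x | ENNReal.ofReal y ≤ ‖g x‖ₑ} := by
    intro x hx
    rw [Set.mem_ofPred_eq, ← ofReal_norm, Real.norm_eq_abs]
    exact ENNReal.ofReal_le_ofReal (le_of_lt hx)
  have hyp : ENNReal.ofReal y ^ p ≠ 0 := by
    rw [ENNReal.ofReal_rpow_of_pos hy]
    exact (ENNReal.ofReal_pos.2 (by positivity)).ne'
  have hyt : ENNReal.ofReal y ^ p ≠ ⊤ := by
    rw [ENNReal.ofReal_rpow_of_pos hy]
    exact ENNReal.ofReal_ne_top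
  rw [← ENNReal.mul_le_mul_iff_right hyp hyt]
  calc ENNReal.ofReal y ^ p * μ {x | y < |g x|}
      ≤ ENNReal.ofReal y ^ p * μ {x | ENNReal.ofReal y ≤ ‖g x‖ₑ} := by gcongr
    _ ≤ eLpNorm g (ENNReal.ofReal p) μ ^ p := hM
    _ ≤ ENNReal.ofReal (y * Real.exp (-1)) ^ p := by
        gcongr
        exact h.trans (ENNReal.ofReal_le_ofReal h1)
    _ = ENNReal.ofReal y ^ p * ENNReal.ofReal (Real.exp (-c * y ^ 2)) := by
        rw [ENNReal.ofReal_mul hy.le, ENNReal.mul_rpow_of_nonneg _ _ hp0.le]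
        congr 1
        rw [ENNReal.ofReal_rpow_of_pos (Real.exp_pos _), ← Real.exp_mul, hp]
        ring_nf

end SignedSmallBall

/-! ### Passage to real exponents and the tail bound -/

theorem mainTheorem2 (d : ℕ) [NeZero d] (hd : 3 ≤ d) :
    ∃ c C : ℝ, 0 < c ∧ c < 1 ∧ 0 < C ∧
      ∀ (n : ℕ) (_ : 1 ≤ n) (a κ : ℝ) (_ : 0 < a) (_ : a < 1) (_ : 0 < κ) (_ : κ < 1)
        (q : ℕ) (_ : q = SignedSmallBall.blockCount d n a κ)
        (I : Fin q → Finset ℕ) (_ : SignedSmallBall.IsEqualDivision n q I)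
        (α : SignedSmallBall.DyadicRectangle d → ℝ)
        (_ : ∀ R, ∑ k, (R k).scale = n → α R = 1 ∨ α R = -1) (t : Fin q),
        (∀ p : ℝ, 1 ≤ p → p ≤ c * ((n : ℝ) / q) ^ (1 / (2 * (d : ℝ) - 1)) →
          eLpNorm (fun x => SignedSmallBall.rho d n q * SignedSmallBall.blockSum n (I t) α x)
            (ENNReal.ofReal p) (SignedSmallBall.cubeMeasure d) ≤ ENNReal.ofReal (C * √p)) ∧
        (∀ y : ℝ, 0 ≤ y → y < c * ((n : ℝ) / q) ^ (1 / (4 * (d : ℝ) - 2)) →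
          SignedSmallBall.cubeMeasure d
              {x | y < |SignedSmallBall.rho d n q * SignedSmallBall.blockSum n (I t) α x|} ≤
            ENNReal.ofReal (C * Real.exp (-c * y ^ 2))) := by
  obtain ⟨C₃, hC₃, hmain⟩ := SignedSmallBall.exists_eLpNorm_blockSum_le d hd
  have hd' : (3 : ℝ) ≤ d := by exact_mod_cast hd
  set C₄ : ℝ := 2 * C₃ with hC₄
  have hC₄0 : 0 < C₄ := by positivity
  -- Small enough for both `c ≤ 1 / 2` and the condition `9 C₄² c ≤ 1` of the tail estimate.
  set c : ℝ := 1 / (2 + 9 * C₄ ^ 2) with hc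
  have hc0 : 0 < c := by positivity
  have hc1 : c ≤ 1 / 2 := by
    rw [hc]
    gcongr
    nlinarith
  have hCc : 9 * (C₄ ^ 2 * c) ≤ 1 := by
    rw [hc, ← mul_assoc, mul_one_div, div_le_one (by positivity)]
    linarith
  refine ⟨c, C₄ + 3, hc0, by linarith, by positivity, ?_⟩
  intro n hn a κ ha ha1 hκ _ q hq I hI α hα t
  set Lam : ℝ := (n : ℝ) / q with hLam
  have hLam0 : 0 ≤ Lam := by positivity
  set lam : ℝ := Lam ^ (1 / (2 * (d : ℝ) - 1)) with hlam
  have hlam0 : 0 ≤ lam := by positivity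
  have hmeas := SignedSmallBall.aestronglyMeasurable_blockSum d n (I t) α
    (SignedSmallBall.rho d n q)
  have hmom : ∀ p : ℝ, 1 ≤ p → p ≤ c * lam →
      eLpNorm (fun x => SignedSmallBall.rho d n q * SignedSmallBall.blockSum n (I t) α x)
        (ENNReal.ofReal p) (SignedSmallBall.cubeMeasure d) ≤ ENNReal.ofReal (C₄ * √p) := by
    intro p hp1 hp
    have hp2 : 2 * p ≤ lam := by nlinarith
    have hceil : 1 ≤ ⌈p⌉₊ := Nat.one_le_ceil_iff.2 (by linarith)
    have hceil' : (⌈p⌉₊ : ℝ) < p + 1 := Nat.ceil_lt_add_one (by linarith)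
    have hle : p ≤ (⌈p⌉₊ : ℝ) := Nat.le_ceil p
    -- The exponent is raised to the even integer `2 m` with `m = ⌈p⌉₊ + 1`, so that `m ≥ 2`; since
    -- `1 ≤ p` and `2 p ≤ lam`, this `m` stays within `4 lam`.
    have h1 := hmain n hn a κ ha ha1 hκ q hq I hI α hα t (⌈p⌉₊ + 1) (by omega)
      (by push_cast; linarith)
    refine (eLpNorm_le_eLpNorm_of_exponent_le (ENNReal.ofReal_le_ofReal ?_) hmeas).trans
      (h1.trans (ENNReal.ofReal_le_ofReal ?_))
    · push_cast; linarith
    · have h2 : √((⌈p⌉₊ + 1 : ℕ) : ℝ) ≤ 2 * √p := by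
        rw [Real.sqrt_le_left (by positivity), mul_pow, Real.sq_sqrt (by linarith)]
        push_cast
        linarith
      calc C₃ * √((⌈p⌉₊ + 1 : ℕ) : ℝ) ≤ C₃ * (2 * √p) := by gcongr
        _ = C₄ * √p := by rw [hC₄]; ring
  constructor
  · intro p hp1 hp
    refine (hmom p hp1 hp).trans (ENNReal.ofReal_le_ofReal ?_)
    gcongr
    linarith
  · intro y hy0 hy
    -- Below `1` the exponent `p = c y²` is not admissible, but there `exp (-c y²) ≥ 1 / e`, and the
    -- constant `C₄ + 3` makes the bound trivial.
    rcases lt_or_ge (c * y ^ 2) 1 with hlt | hge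
    · refine prob_le_one.trans ?_
      rw [← ENNReal.ofReal_one]
      refine ENNReal.ofReal_le_ofReal ?_
      have he : Real.exp (-1) ≤ Real.exp (-c * y ^ 2) := Real.exp_le_exp.2 (by linarith)
      have h3 : 1 ≤ 3 * Real.exp (-1) := by
        rw [Real.exp_neg, ← div_eq_mul_inv, le_div_iff₀ (Real.exp_pos 1)]
        linarith [Real.exp_one_lt_d9]
      calc (1 : ℝ) ≤ 3 * Real.exp (-1) := h3
        _ ≤ (C₄ + 3) * Real.exp (-c * y ^ 2) := by gcongr; linarith
    · have hy1 : 0 < y := by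
        rcases hy0.eq_or_lt with h | h
        · rw [← h] at hge; norm_num at hge
        · exact h
      have hsq : (Lam ^ (1 / (4 * (d : ℝ) - 2))) ^ 2 = lam := by
        rw [hlam, ← Real.rpow_natCast, ← Real.rpow_mul hLam0]
        congr 1
        have h1 : 2 * (d : ℝ) - 1 ≠ 0 := by linarith
        have h2 : 4 * (d : ℝ) - 2 = 2 * (2 * d - 1) := by ring
        rw [h2]
        field_simp
        norm_num
      have hy2 : y ^ 2 ≤ lam := by
        calc y ^ 2 ≤ (c * Lam ^ (1 / (4 * (d : ℝ) - 2))) ^ 2 := by gcongr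
          _ = c ^ 2 * lam := by rw [mul_pow, hsq]
          _ ≤ 1 * lam := by gcongr; nlinarith
          _ = lam := one_mul _
      refine (SignedSmallBall.measure_lt_abs_le_of_eLpNorm_le hmeas hc0 hCc hy1
        (hmom _ hge (by gcongr))).trans (ENNReal.ofReal_le_ofReal ?_)
      have : 0 < Real.exp (-c * y ^ 2) := Real.exp_pos _
      nlinarith
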